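/- Let $p$ be an odd prime, let $\mathbf F$ be a field of characteristic $p$, and let $L=\bigoplus_{i\ge 1}L_i$ be an infinite-dimensional graded Lie algebra of maximal class over $\mathbf F$; that is, $L$ is infinite-dimensional, $\dim L_1=2$, $\dim L_i\le 1$ for $i\ge 2$, and $L$ is generated by $L_1$. For $i\ge 2$ let $C_i=C_{L_1}(L_i)=\{x\in L_1 : [v,x]=0 \text{ for all } v\in L_i\}$ be the two-step centralizers. If $n$ is the least index with $C_n\ne C_2$, then $C_2$ and $C_n$ are called the first and the second two-step centralizer, and $C_2,\dots,C_n$ is called the first constituent, of length $n$. Any other constituent is a segment $C_{i+1},\dots,C_{i+m}$ ($m\ge 1$) with $i\ge 2$, $C_i\ne C_2$, $C_{i+m}\ne C_2$ and $C_{i+1}=\dots=C_{i+m-1}=C_2$; its length is $m$. Let $q=p^h$ and $r=p^k$ with $k\ge 1$, let $0\le\beta<h$, and let $s\ge 1$ be an integer. Suppose that there is an initial segment of the sequence $(C_i)_{i\ge 2}$ that involves only the first two two-step centralizers, and that the corresponding initial segment of the sequence of constituent lengths of $L$ is $$2q,\ q^{r-2},\ 2q-p^\beta,\ (q^{r-2},2q)^{s-1},\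 q^{r-2},\ 2q-p^\beta,$$ where exponents on terms or on bracketed blocks denote the number of repetitions. Then $s=p^l$ for some integer $l\ge 0$. -/

import Mathlib

/-!
Graded Lie algebras of maximal class, their two-step centralizers and their constituents.
-/

namespace MaxClass

section

variable {F L : Type*} [Field F] [LieRing L] [LieAlgebra F L]

/-- `L = ⨁_{i ≥ 1} L_i` (the summand of degree `0` of an `ℕ`-grading being zero) is an algebra of
maximal class: `dim L_1 = 2`, `dim L_i ≤ 1` for `i ≥ 2`, and `L` is generated by `L_1`. -/
structure IsMaximalClass (A : ℕ → Submodule F L) [GradedLieAlgebra A] : Prop where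
  zero_eq_bot : A 0 = ⊥
  rank_one : Module.rank F (A 1) = 2
  rank_le_one : ∀ i, 2 ≤ i → Module.rank F (A i) ≤ 1
  generated : LieSubalgebra.lieSpan F L (A 1 : Set L) = ⊤

/-- The two-step centralizer `C_i = C_{L_1}(L_i)`. -/
def twoStepCentralizer (A : ℕ → Submodule F L) (i : ℕ) : Submodule F L where
  carrier := {x | x ∈ A 1 ∧ ∀ v ∈ A i, ⁅v, x⁆ = 0}
  add_mem' := by
    rintro x y ⟨hx, hx'⟩ ⟨hy, hy'⟩
    exact ⟨(A 1).add_mem hx hy, fun v hv => by rw [lie_add, hx' v hv, hy' v hv, add_zero]⟩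
  zero_mem' := ⟨(A 1).zero_mem, fun v _ => lie_zero v⟩
  smul_mem' := by
    rintro c x ⟨hx, hx'⟩
    exact ⟨(A 1).smul_mem c hx, fun v hv => by rw [lie_smul, hx' v hv, smul_zero]⟩

/-- The second two-step centralizer (in order of occurrence) first occurs in weight `n`. The first
constituent is then `C_2, …, C_n`; by convention its length is `n`. -/
def IsFirstConstituent (A : ℕ → Submodule F L) (n : ℕ) : Prop :=
  2 ≤ n ∧ twoStepCentralizer A n ≠ twoStepCentralizer A 2 ∧
    ∀ j, 2 ≤ j → j < n → twoStepCentralizer A j = twoStepCentralizer A 2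

/-- `C_{i+1}, …, C_{i+m}` is a constituent of length `m` (other than the first one). -/
def IsConstituent (A : ℕ → Submodule F L) (i m : ℕ) : Prop :=
  2 ≤ i ∧ 1 ≤ m ∧ twoStepCentralizer A i ≠ twoStepCentralizer A 2 ∧
    twoStepCentralizer A (i + m) ≠ twoStepCentralizer A 2 ∧
    ∀ j, i < j → j < i + m → twoStepCentralizer A j = twoStepCentralizer A 2

/-- The constituents following weight `i` have, in order, the lengths in the given list. -/
def HasConstituentsFrom (A : ℕ → Submodule F L) : ℕ → List ℕ → Prop
  | _, [] => True
  | i, m :: ms => IsConstituent A i m ∧ HasConstituentsFrom A (i + m) ms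

/-- The sequence of constituent lengths begins with the given list. The corresponding initial
segment of the sequence of two-step centralizers is `C_2, …, C_N`, with `N` the sum of the list. -/
def ConstituentLengthsBeginWith (A : ℕ → Submodule F L) : List ℕ → Prop
  | [] => True
  | n :: ms => IsFirstConstituent A n ∧ HasConstituentsFrom A n ms

/-- The segment `C_2, …, C_N` involves only the first two two-step centralizers, in order of
occurrence in the whole sequence. -/
def OnlyFirstTwoUpTo (A : ℕ → Submodule F L) (N : ℕ) : Prop :=
  ∀ i, 2 ≤ i → i ≤ N → twoStepCentralizer A i = twoStepCentralizer A 2 ∨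
    ∃ n, IsFirstConstituent A n ∧ twoStepCentralizer A i = twoStepCentralizer A n

end

/-- The list `2q, q^{r-2}, 2q - d, (q^{r-2}, 2q)^{s-1}, q^{r-2}, 2q - d`, exponents denoting
repetition. -/
def initialPattern (q r d s : ℕ) : List ℕ :=
  [2 * q] ++ List.replicate (r - 2) q ++ [2 * q - d] ++
    (List.replicate (s - 1) (List.replicate (r - 2) q ++ [2 * q])).flatten ++
    List.replicate (r - 2) q ++ [2 * q - d]

end MaxClass

/-! Let `y` span `C_2`, let `x` span the second centralizer, and let `σ` be the shift of sequences.
Over `F(X)` the element `z = x + X y` centralizes no `L_i`, so `e_1 = X y`, `e_(i+1) = [e_i, z]` are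
nonzero and `[e_i, e_1] = ε_i e_(i+1)`, where `ε_i` is `0` if `C_i = C_2` and `1` if `C_i` is the
second centralizer. By induction `[e_m, e_(k+1)] = ((1 - σ)^k ε)_m e_(m+k+1)`, so the Lie axioms
become identities for a scalar sequence (`IsAdmissible`). In characteristic `p`, `(1 - σ)^(p^t) = 1
- σ^(p^t)`, which makes these identities computable on almost periodic sequences.

With `d = p^β`, the hypothesis says that up to weight `q r (s + 1) + 2q - 2d` the sequence `ε` is a
comb of period `q r`, shifted by `d` after one period and again after `s` more (`pattern`). Past the
first period, `1 - σ^(q r)` reduces it to a single period differenced by `(1 - σ)^d`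
(`iterDiff_pattern`).

Suppose `s = p^l (c + 2)` with `c + 2` prime to `p`, and put `Q = q r p^l`. The pattern is forced to
continue without a third shift for `p^l` more periods (`agree_up_to`). At weight `q r (s + 1) + Q +
2q - 2d` its defect of skew-symmetry is `c + 2`, nonzero in `F` (`skewDefect_pattern_eq`): a
contradiction.

For the continuation, the Jacobi identity restricts the gaps between nonzero terms. Skew-symmetry
determines `ε_i` directly for odd `i`, and through weight `i + d` for even `i`. The one deviation
that survives is a third shift after exactly `p^l` periods when `c + 2 ≡ 1` modulo `p`; a further
Jacobi identity excludes it (`false_of_third_shift`). -/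

namespace MaxClass

/-! ### Iterated differences in characteristic `p`. -/

section Differences

variable {K : Type*} [Field K]

/-- The iterated difference `((1 - σ) ^ k f) m`, where `σ` is the shift of sequences. -/
def iterDiff (f : ℕ → K) : ℕ → ℕ → K
  | m, 0 => f m
  | m, k + 1 => iterDiff f m k - iterDiff f (m + 1) k

@[simp] theorem iterDiff_zero (f : ℕ → K) (m : ℕ) : iterDiff f m 0 = f m := rfl

theorem iterDiff_succ (f : ℕ → K) (m k : ℕ) :
    iterDiff f m (k + 1) = iterDiff f m k - iterDiff f (m + 1) k := rfl

theorem iterDiff_congr {f g : ℕ → K} {m k : ℕ} (h : ∀ x, m ≤ x → x ≤ m + k → f x = g x) :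
    iterDiff f m k = iterDiff g m k := by
  induction k generalizing m with
  | zero => exact h m le_rfl le_rfl
  | succ k ih =>
    rw [iterDiff_succ, iterDiff_succ, ih fun x h1 h2 => h x h1 (by omega),
      ih fun x h1 h2 => h x (by omega) (by omega)]

theorem iterDiff_add (f g : ℕ → K) (m k : ℕ) :
    iterDiff (f + g) m k = iterDiff f m k + iterDiff g m k := by
  induction k generalizing m with
  | zero => rfl
  | succ k ih => rw [iterDiff_succ, iterDiff_succ, iterDiff_succ, ih, ih]; ring

theorem iterDiff_zero_fun (m k : ℕ) : iterDiff (fun _ => (0 : K)) m k = 0 := by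
  induction k generalizing m with
  | zero => rfl
  | succ k ih => rw [iterDiff_succ, ih, ih, sub_zero]

theorem iterDiff_const (c : K) (m k : ℕ) : iterDiff (fun _ => c) m (k + 1) = 0 := by
  induction k generalizing m with
  | zero => simp [iterDiff_succ]
  | succ k ih => rw [iterDiff_succ, ih, ih, sub_zero]

theorem iterDiff_eq_zero {f : ℕ → K} {m k : ℕ} (h : ∀ x, m ≤ x → x ≤ m + k → f x = 0) :
    iterDiff f m k = 0 :=
  (iterDiff_congr h).trans (iterDiff_zero_fun m k)

theorem iterDiff_iterDiff (f : ℕ → K) (a m k : ℕ) :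
    iterDiff (fun x => iterDiff f x a) m k = iterDiff f m (a + k) := by
  induction k generalizing m with
  | zero => rfl
  | succ k ih => rw [iterDiff_succ, ih, ih, ← add_assoc, iterDiff_succ]

theorem iterDiff_eq_sum (f : ℕ → K) (m k : ℕ) :
    iterDiff f m k = ∑ j ∈ Finset.range (k + 1), (-1) ^ j * (k.choose j : K) * f (m + j) := by
  induction k generalizing m with
  | zero => simp
  | succ k ih =>
    rw [iterDiff_succ, ih, ih, Finset.sum_range_succ' _ (k + 1)]
    have h1 : ∀ j ∈ Finset.range (k + 1),
        (-1 : K) ^ (j + 1) * ((k + 1).choose (j + 1) : K) * f (m + (j + 1)) =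
        (-1) ^ (j + 1) * (k.choose (j + 1) : K) * f (m + (j + 1)) -
          (-1) ^ j * (k.choose j : K) * f (m + 1 + j) := by
      intro j _
      rw [Nat.choose_succ_succ, show m + 1 + j = m + (j + 1) by ring]
      push_cast
      ring
    rw [Finset.sum_congr rfl h1, Finset.sum_sub_distrib]
    have h2 := Finset.sum_range_succ' (fun j => (-1 : K) ^ j * (k.choose j : K) * f (m + j)) (k + 1)
    rw [Finset.sum_range_succ (fun j => (-1 : K) ^ j * (k.choose j : K) * f (m + j)) (k + 1)] at h2
    simp only [Nat.choose_succ_self, Nat.cast_zero, mul_zero, zero_mul, add_zero] at h2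
    rw [h2]
    simp
    ring

theorem iterDiff_eq_of_support {f : ℕ → K} {m k y : ℕ} (h1 : m ≤ y) (h2 : y ≤ m + k)
    (h : ∀ x, m ≤ x → x ≤ m + k → x ≠ y → f x = 0) :
    iterDiff f m k = (-1) ^ (y - m) * (k.choose (y - m) : K) * f y := by
  rw [iterDiff_eq_sum, Finset.sum_eq_single (y - m)]
  · rw [show m + (y - m) = y by omega]
  · intro j hj hne
    rw [Finset.mem_range] at hj
    rw [h (m + j) (by omega) (by omega) (by omega), mul_zero]
  · intro hj
    rw [Finset.mem_range] at hj
    omega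

theorem iterDiff_single {m k y : ℕ} (c : K) (h1 : m ≤ y) (h2 : y ≤ m + k) :
    iterDiff (Pi.single y c) m k = (-1) ^ (y - m) * (k.choose (y - m) : K) * c := by
  rw [iterDiff_eq_of_support h1 h2 fun x _ _ hx => by rw [Pi.single_eq_of_ne hx],
    Pi.single_eq_same]

theorem neg_one_pow_prime_pow {p : ℕ} (hp : p.Prime) (hp2 : p ≠ 2) (t : ℕ) : (-1 : K) ^ p ^ t = -1 :=
  ((hp.odd_of_ne_two hp2).pow).neg_one_pow

variable (p : ℕ) [CharP K p]

/-- Frobenius for the shift, `(1 - σ)^(p^t) = 1 + (-σ)^(p^t)`: `p` divides the inner binomial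
coefficients. -/
theorem iterDiff_prime_pow (hp : p.Prime) (f : ℕ → K) (m t : ℕ) :
    iterDiff f m (p ^ t) = f m + (-1) ^ p ^ t * f (m + p ^ t) := by
  have hpos : 0 < p ^ t := pow_pos hp.pos t
  rw [iterDiff_eq_sum, Finset.sum_range_succ, ← Nat.succ_pred_eq_of_pos hpos,
    Finset.sum_range_succ', Finset.sum_eq_zero]
  · simp
  · intro j hj
    rw [Finset.mem_range] at hj
    have h1 : (((p ^ t).pred.succ).choose (j + 1) : K) = 0 := by
      rw [CharP.cast_eq_zero_iff K p]
      rw [Nat.succ_pred_eq_of_pos hpos]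
      have := Nat.succ_pred_eq_of_pos hpos
      exact hp.dvd_choose_pow (by omega) (by omega)
    rw [h1]
    ring

theorem iterDiff_prime_pow_add (hp : p.Prime) (hp2 : p ≠ 2) (f : ℕ → K) (m t k : ℕ) :
    iterDiff f m (p ^ t + k) = iterDiff f m k - iterDiff f (m + p ^ t) k := by
  rw [add_comm, ← iterDiff_iterDiff, iterDiff_prime_pow p hp, neg_one_pow_prime_pow hp hp2]
  ring

/-- `(1 - σ)^(p^t u + k) = (1 - σ^(p^t))^u (1 - σ)^k`: a long difference is a difference of order
`u` of short ones, whose windows start `p^t` apart. Later evaluations choose the order so that few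
of these windows meet the support. -/
theorem iterDiff_dilate (hp : p.Prime) (hp2 : p ≠ 2) (f : ℕ → K) (m t k i u : ℕ) :
    iterDiff f (m + p ^ t * i) (p ^ t * u + k) =
      iterDiff (fun j => iterDiff f (m + p ^ t * j) k) i u := by
  induction u generalizing i with
  | zero => simp
  | succ u ih =>
    rw [iterDiff_succ, ← ih, ← ih, show p ^ t * (u + 1) + k = p ^ t + (p ^ t * u + k) by ring,
      iterDiff_prime_pow_add p hp hp2]
    congr 2
    ring

/-- By Pascal's rule modulo `p`, all signed coefficients of `(1 - σ)^(p^t - 1)` are equal to `1`.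
Such a difference detects an isolated nonzero term anywhere in its window. -/
theorem iterDiff_window (hp : p.Prime) (f : ℕ → K) (m t : ℕ) :
    iterDiff f m (p ^ t - 1) = ∑ j ∈ Finset.range (p ^ t), f (m + j) := by
  have hpos : 0 < p ^ t := pow_pos hp.pos t
  have key : ∀ j, j < p ^ t → (-1 : K) ^ j * ((p ^ t - 1).choose j : K) = 1 := by
    intro j
    induction j with
    | zero => simp
    | succ j ih =>
      intro hj
      have h1 := ih (by omega)
      have h2 : ((p ^ t).choose (j + 1) : K) = 0 := by
        rw [CharP.cast_eq_zero_iff K p]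
        exact hp.dvd_choose_pow (by omega) (by omega)
      have h3 : (p ^ t).choose (j + 1) = (p ^ t - 1).choose j + (p ^ t - 1).choose (j + 1) := by
        conv_lhs => rw [show p ^ t = (p ^ t - 1) + 1 by omega]
        rw [Nat.choose_succ_succ]
      rw [h3] at h2
      push_cast at h2
      rw [pow_succ]
      linear_combination h1 - (-1) ^ j * h2
  rw [iterDiff_eq_sum, Nat.sub_add_cancel hpos]
  refine Finset.sum_congr rfl fun j hj => ?_
  rw [key j (Finset.mem_range.1 hj), one_mul]

theorem iterDiff_window_eq_zero (hp : p.Prime) {f : ℕ → K} {m t : ℕ}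
    (h : ∀ x, m ≤ x → x < m + p ^ t → f x = 0) : iterDiff f m (p ^ t - 1) = 0 := by
  rw [iterDiff_window p hp]
  exact Finset.sum_eq_zero fun j hj => h _ (by omega) (by have := Finset.mem_range.1 hj; omega)

theorem iterDiff_window_eq (hp : p.Prime) {f : ℕ → K} {m t y : ℕ}
    (h1 : m ≤ y) (h2 : y < m + p ^ t) (h : ∀ x, m ≤ x → x < m + p ^ t → x ≠ y → f x = 0) :
    iterDiff f m (p ^ t - 1) = f y := by
  rw [iterDiff_window p hp, Finset.sum_eq_single (y - m)]
  · rw [show m + (y - m) = y by omega]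
  · intro j hj hne
    have := Finset.mem_range.1 hj
    exact h _ (by omega) (by omega) (by omega)
  · intro hj
    rw [Finset.mem_range] at hj
    omega

/-- Lucas' theorem, dropping the lowest digit of both entries at each step. -/
theorem choose_prime_pow (hp : p.Prime) (n v : ℕ) : (n.choose (p ^ v) : K) = (n / p ^ v : ℕ) := by
  have := Fact.mk hp
  rw [CharP.cast_eq_iff_mod_eq K p]
  induction v generalizing n with
  | zero => simp
  | succ v ih =>
    have h := Choose.choose_modEq_choose_mod_mul_choose_div_nat (n := n) (k := p ^ (v + 1)) (p := p)
    rw [show p ^ (v + 1) % p = 0 from Nat.mod_eq_zero_of_dvd (dvd_pow_self p (by omega)),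
      Nat.choose_zero_right, one_mul, pow_succ, Nat.mul_div_cancel _ hp.pos] at h
    rw [pow_succ]
    refine Eq.trans h ?_
    rw [mul_comm, ← Nat.div_div_eq_div_mul]
    exact ih _

/-- The binomial coefficient `C(n, p^v)` is, modulo `p`, the digit of `n` at `p^v`. -/
theorem choose_prime_pow_eq_neg (hp : p.Prime) {n v c w e : ℕ} (he : e < p ^ v)
    (h : n + c * p ^ v = p ^ v * (p * w) + e) : (n.choose (p ^ v) : K) = -(c : K) := by
  rw [choose_prime_pow p hp]
  have h1 : n / p ^ v + c = p * w := by
    have h2 := congrArg (· / p ^ v) h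
    rwa [Nat.add_mul_div_right _ _ (pow_pos hp.pos v), Nat.mul_add_div (pow_pos hp.pos v),
      Nat.div_eq_of_lt he, add_zero] at h2
  have h3 := congrArg (Nat.cast : ℕ → K) h1
  push_cast at h3
  rw [CharP.cast_eq_zero K p, zero_mul] at h3
  linear_combination h3

/-- A case of Lucas, obtained by evaluating the difference of order `p^v a + b` of the delta
sequence at `e`: the windows of length `b + 1` starting at multiples of `p^v` all miss `e`. -/
theorem choose_eq_zero_of_lt (hp : p.Prime) (hp2 : p ≠ 2) {v a b e : ℕ} (he : e < p ^ v)
    (hb : b < e) : ((p ^ v * a + b).choose e : K) = 0 := by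
  have h1 := iterDiff_dilate (K := K) p hp hp2 (Pi.single e 1) 0 v b 0 a
  rw [mul_zero, zero_add] at h1
  have h2 : iterDiff (Pi.single e (1 : K)) 0 (p ^ v * a + b) = 0 := by
    rw [h1]
    refine iterDiff_eq_zero fun i _ _ => iterDiff_eq_zero fun x hx1 hx2 => ?_
    refine Pi.single_eq_of_ne ?_ 1
    rintro rfl
    rcases Nat.eq_zero_or_pos i with rfl | hi
    · simp at hx2
      omega
    · have := Nat.le_mul_of_pos_right (p ^ v) hi
      omega
  by_cases hle : e ≤ p ^ v * a + b
  · rw [iterDiff_single 1 (Nat.zero_le e) (by omega), Nat.sub_zero, mul_one] at h2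
    simpa using h2
  · rw [Nat.choose_eq_zero_of_lt (by omega), Nat.cast_zero]

end Differences

/-! ### Gaps between nonzero terms, from the Jacobi identity. -/

section Gaps

variable {K : Type*} [Field K]

/-- The identities satisfied by the structure constants `[e_i, y] = ε_i e_{i+1}`: skew-symmetry of
the bracket of `e_{a+1}` and `e_{b+1}`, and the Jacobi identity for `e_{m+1}`, `e_{k+1}`, `y`. -/
structure IsAdmissible (ε : ℕ → K) : Prop where
  skew : ∀ a b, iterDiff ε (a + 1) b = -iterDiff ε (b + 1) a
  jacobi : ∀ m k, iterDiff ε (m + 1) k * ε (m + k + 2) =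
    ε (m + 1) * iterDiff ε (m + 2) k + ε (k + 1) * iterDiff ε (m + 1) (k + 1)

namespace IsAdmissible

variable {ε : ℕ → K} (hε : IsAdmissible ε)
include hε

/-- In the Lie algebra: `e_1` commutes with `e_m` and `e_k`, hence with their bracket, a nonzero
multiple of `e_(m+k)`. For terms equal to `1` the same argument runs with `z - e_1` in place of
`e_1`. -/
theorem eq_zero_of_zero_zero {m k : ℕ} (hm : 1 ≤ m) (hk : 1 ≤ k) (h1 : ε m = 0) (h2 : ε k = 0)
    (h3 : iterDiff ε m (k - 1) ≠ 0) : ε (m + k) = 0 := by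
  obtain ⟨m, rfl⟩ := Nat.exists_eq_add_of_le' hm
  obtain ⟨k, rfl⟩ := Nat.exists_eq_add_of_le' hk
  have h := hε.jacobi m k
  rw [h1, h2, zero_mul, zero_mul, add_zero] at h
  rw [show m + 1 + (k + 1) = m + k + 2 by ring]
  exact (mul_eq_zero.1 h).resolve_left h3

theorem eq_one_of_one_one {m k : ℕ} (hm : 1 ≤ m) (hk : 1 ≤ k) (h1 : ε m = 1) (h2 : ε k = 1)
    (h3 : iterDiff ε m (k - 1) ≠ 0) : ε (m + k) = 1 := by
  obtain ⟨m, rfl⟩ := Nat.exists_eq_add_of_le' hm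
  obtain ⟨k, rfl⟩ := Nat.exists_eq_add_of_le' hk
  have h := hε.jacobi m k
  rw [h1, h2, iterDiff_succ] at h
  rw [show m + 1 + (k + 1) = m + k + 2 by ring]
  refine mul_left_cancel₀ h3 ?_
  rw [Nat.add_sub_cancel]
  linear_combination h

theorem mul_eq_of_zero_one {m k : ℕ} (hm : 1 ≤ m) (hk : 1 ≤ k) (h1 : ε m = 0) (h2 : ε k = 1) :
    iterDiff ε m (k - 1) * ε (m + k) = iterDiff ε m (k - 1) - iterDiff ε (m + 1) (k - 1) := by
  obtain ⟨m, rfl⟩ := Nat.exists_eq_add_of_le' hm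
  obtain ⟨k, rfl⟩ := Nat.exists_eq_add_of_le' hk
  have h := hε.jacobi m k
  rw [h1, h2, iterDiff_succ] at h
  rw [show m + 1 + (k + 1) = m + k + 2 by ring, Nat.add_sub_cancel]
  linear_combination h

variable {p : ℕ} [CharP K p] {h : ℕ}

/-- A nonzero term preceded by zeros in a window of length `q` is followed by zeros in such a
window. -/
theorem zero_after (hp : p.Prime) (hsmall : ∀ x, 1 ≤ x → x < 2 * p ^ h → ε x = 0)
    {N : ℕ} (hN1 : 1 ≤ N) (hN : ε N ≠ 0) (hz : ∀ x, N < x + p ^ h → x < N → ε x = 0) :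
    ∀ x, N < x → x < N + p ^ h → ε x = 0 := by
  have hpos : 0 < p ^ h := pow_pos hp.pos h
  have hN2 : 2 * p ^ h ≤ N := by
    by_contra hlt
    exact hN (hsmall N hN1 (by omega))
  intro x
  induction x using Nat.strong_induction_on with
  | _ x ih =>
    intro h1 h2
    -- Jacobi at `x - q` and `q`: the window of length `q` from `x - q` sees only the term at `N`,
    -- those between `N` and `x` vanishing by induction.
    have h3 : ε (x - p ^ h + p ^ h) = 0 := by
      refine hε.eq_zero_of_zero_zero (by omega) (by omega) (hz _ (by omega) (by omega))
        (hsmall _ (by omega) (by omega)) ?_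
      rw [iterDiff_window_eq p hp (y := N) (by omega) (by omega)]
      · exact hN
      · intro y hy1 hy2 hy3
        rcases lt_or_gt_of_ne hy3 with hlt | hgt
        · exact hz y (by omega) hlt
        · exact ih y (by omega) hgt (by omega)
    rwa [Nat.sub_add_cancel (by omega)] at h3

/-- The possible lengths, between `q` and `2q`, of a gap between nonzero terms. -/
theorem gap_length (hp : p.Prime) (hsmall : ∀ x, 1 ≤ x → x < 2 * p ^ h → ε x = 0)
    {N j : ℕ} (hN1 : 1 ≤ N) (hN : ε N ≠ 0) (hz : ∀ x, N < x + p ^ h → x < N → ε x = 0)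
    (hz' : ∀ x, N < x → x < N + j → ε x = 0) (hj1 : p ^ h < j) (hj2 : j < 2 * p ^ h)
    (hj : ε (N + j) ≠ 0) : ∃ t, t < h ∧ j + p ^ t = 2 * p ^ h := by
  have hpos : 0 < p ^ h := pow_pos hp.pos h
  have hN2 : 2 * p ^ h ≤ N := by
    by_contra hlt
    exact hN (hsmall N hN1 (by omega))
  obtain ⟨v, w, hw, hjv⟩ := Nat.exists_eq_pow_mul_and_not_dvd (n := j) (by omega) p hp.ne_one
  have hv : v < h := by
    by_contra hle
    have h1 : p ^ h ∣ j := by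
      rw [hjv]
      exact (pow_dvd_pow p (by omega)).mul_right w
    obtain ⟨c, rfl⟩ := h1
    have h2 : 1 < c := by
      by_contra hc
      have : p ^ h * c ≤ p ^ h * 1 := Nat.mul_le_mul_left _ (by omega)
      omega
    have : p ^ h * 2 ≤ p ^ h * c := Nat.mul_le_mul_left _ h2
    omega
  have hvpos : 0 < p ^ v := pow_pos hp.pos v
  have hvlt : p ^ v < p ^ h := Nat.pow_lt_pow_right hp.one_lt hv
  refine ⟨v, hv, ?_⟩
  by_contra hne
  have hdvd : p ^ v ∣ 2 * p ^ h - j :=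
    Nat.dvd_sub ((pow_dvd_pow p hv.le).mul_left 2) (Dvd.intro _ hjv.symm)
  have hle := Nat.le_of_dvd (by omega) hdvd
  apply hj
  -- Both `N - p^v` and `j + p^v < 2q` are positions of zeros. The coefficient is, up to sign, `C(j
  -- + p^v - 1, p^v) ε_N`, and this binomial is congruent to `w = j / p^v`, which is prime to `p`.
  rw [show N + j = (N - p ^ v) + (j + p ^ v) by omega]
  refine hε.eq_zero_of_zero_zero (by omega) (by omega) (hz _ (by omega) (by omega))
    (hsmall _ (by omega) (by omega)) ?_
  rw [iterDiff_eq_of_support (y := N) (by omega) (by omega)]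
  · rw [show N - (N - p ^ v) = p ^ v by omega, choose_prime_pow p hp]
    have h1 : (j + p ^ v - 1) / p ^ v = w := by
      rw [hjv, show p ^ v * w + p ^ v - 1 = p ^ v * w + (p ^ v - 1) by omega,
        Nat.mul_add_div hvpos, Nat.div_eq_of_lt (by omega), add_zero]
    rw [h1]
    refine mul_ne_zero (mul_ne_zero (pow_ne_zero _ (neg_ne_zero.2 one_ne_zero)) ?_) hN
    rwa [Ne, CharP.cast_eq_zero_iff K p]
  · intro x hx1 hx2 hx3
    rcases lt_or_gt_of_ne hx3 with hlt | hgt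
    · exact hz x (by omega) hlt
    · exact hz' x hgt (by omega)

/-- After a term `1` and `2q - 1` zeros there is another term `1`. -/
theorem one_of_full_gap (hp : p.Prime) (hp2 : p ≠ 2)
    (h2q : ε (2 * p ^ h) = 1) {N : ℕ} (hN1 : 1 ≤ N) (hN : ε N = 1)
    (hz : ∀ x, N < x → x < N + 2 * p ^ h → ε x = 0) : ε (N + 2 * p ^ h) = 1 := by
  have hpos : 0 < p ^ h := pow_pos hp.pos h
  refine hε.eq_one_of_one_one hN1 (by omega) hN h2q ?_
  rw [show 2 * p ^ h - 1 = p ^ h + (p ^ h - 1) by omega, iterDiff_prime_pow_add p hp hp2,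
    iterDiff_window_eq p hp (y := N) (by omega) (by omega) fun x h1 h2 h3 =>
      hz x (by omega) (by omega),
    iterDiff_window_eq_zero p hp fun x h1 h2 => hz x (by omega) (by omega), hN, sub_zero]
  exact one_ne_zero

/-- The terms closing a gap of length `2q - d`, `0 < d < q`, preceded by a gap of length at least
`q`: both this term and the term `q` places later are equal to `1`. -/
theorem eq_one_of_short_gap (hp : p.Prime) (hp2 : p ≠ 2)
    (hsmall : ∀ x, 1 ≤ x → x < 2 * p ^ h → ε x = 0)
    (h2q : ε (2 * p ^ h) = 1) (h3q : ε (3 * p ^ h) = 1)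
    {N d i : ℕ} (hN1 : 1 ≤ N) (hN : ε N = 1) (hd0 : 0 < d) (hd : d < p ^ h)
    (hi : i + d = N + 2 * p ^ h) (hi0 : ε i ≠ 0)
    (hz : ∀ x, N < x + p ^ h → x < N → ε x = 0) (hz' : ∀ x, N < x → x < i → ε x = 0) :
    ε i = 1 ∧ ε (i + p ^ h) = 1 := by
  have hN2 : 2 * p ^ h ≤ N := by
    by_contra hlt
    rw [hsmall N hN1 (by omega)] at hN
    exact zero_ne_one hN
  have hz'' := hε.zero_after hp hsmall (N := i) (by omega) hi0 fun x h1 h2 =>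
    hz' x (by omega) h2
  -- Once the windows are evaluated, `e1` reads `ε_i ε_(i+q) = 2 ε_i - ε_(i+q)` and `e2` reads `(1 +
  -- ε_i) ε_(i+q) = 3 ε_i - ε_(i+q)`. Subtracting gives `ε_(i+q) = ε_i`, and then `ε_i² = ε_i`.
  have e1 := hε.mul_eq_of_zero_one (m := i - p ^ h) (k := 2 * p ^ h) (by omega) (by omega)
    (hz' _ (by omega) (by omega)) h2q
  have e2 := hε.mul_eq_of_zero_one (m := N - d) (k := 3 * p ^ h) (by omega) (by omega)
    (hz _ (by omega) (by omega)) h3q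
  have w1 : iterDiff ε (i - p ^ h) (p ^ h - 1) = 0 :=
    iterDiff_window_eq_zero p hp fun x h1 h2 => hz' x (by omega) (by omega)
  have w2 : iterDiff ε i (p ^ h - 1) = ε i :=
    iterDiff_window_eq p hp (by omega) (by omega) fun x h1 h2 h3 => hz'' x (by omega) (by omega)
  have w3 : iterDiff ε (i - p ^ h + 1) (p ^ h - 1) = ε i :=
    iterDiff_window_eq p hp (by omega) (by omega) fun x h1 h2 h3 => hz' x (by omega) (by omega)
  have w4 : iterDiff ε (i + 1) (p ^ h - 1) = ε (i + p ^ h) :=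
    iterDiff_window_eq p hp (by omega) (by omega) fun x h1 h2 h3 => hz'' x (by omega) (by omega)
  have around : ∀ x, N < x + p ^ h → x < i → x ≠ N → ε x = 0 := fun x h1 h2 h3 => by
    rcases lt_or_gt_of_ne h3 with hlt | hgt
    · exact hz x h1 hlt
    · exact hz' x hgt h2
  have w5 : iterDiff ε (N - d) (p ^ h - 1) = 1 := by
    rw [iterDiff_window_eq p hp (y := N) (by omega) (by omega) fun x h1 h2 h3 =>
      around x (by omega) (by omega) h3, hN]
  have w6 : iterDiff ε (N - d + 1) (p ^ h - 1) = 1 := by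
    rw [iterDiff_window_eq p hp (y := N) (by omega) (by omega) fun x h1 h2 h3 =>
      around x (by omega) (by omega) h3, hN]
  rw [show i - p ^ h + 2 * p ^ h = i + p ^ h by omega,
    show 2 * p ^ h - 1 = p ^ h + (p ^ h - 1) by omega, iterDiff_prime_pow_add p hp hp2,
    iterDiff_prime_pow_add p hp hp2, show i - p ^ h + p ^ h = i by omega,
    show i - p ^ h + 1 + p ^ h = i + 1 by omega, w1, w2, w3, w4] at e1
  rw [show N - d + 3 * p ^ h = i + p ^ h by omega,
    show 3 * p ^ h - 1 = p ^ h + (p ^ h + (p ^ h - 1)) by omega] at e2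
  simp only [iterDiff_prime_pow_add p hp hp2] at e2
  rw [show N - d + p ^ h + p ^ h = i by omega, show N - d + p ^ h = i - p ^ h by omega,
    show N - d + 1 + p ^ h + p ^ h = i + 1 by omega,
    show N - d + 1 + p ^ h = i - p ^ h + 1 by omega, w1, w2, w3, w4, w5, w6] at e2
  have e3 : ε (i + p ^ h) = ε i := by linear_combination e2 + e1
  rw [e3] at e1 ⊢
  have e4 : ε i = 1 := mul_left_cancel₀ hi0 (by linear_combination -e1)
  exact ⟨e4, e4⟩

end IsAdmissible

end Gaps

/-! ### The model sequence with two shifts, and its differences. -/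

section Pattern

variable {K : Type*} [Field K]

/-- The periodic sequence with terms `1` at the multiples `q * a` of `q` with `a ≢ 1` modulo `r`,
and `0` elsewhere. -/
def comb (q r y : ℕ) : K := if q ∣ y ∧ y / q % r ≠ 1 then 1 else 0

/-- The sequence of two-step centralizers with constituent lengths
`2q, q^{r-2}, 2q - d, (q^{r-2}, 2q)^{s-1}, q^{r-2}, 2q - d, (q^{r-2}, 2q)^∞`. -/
def pattern (q r d s x : ℕ) : K :=
  comb q r (x + if x ≤ q * r then 0 else if x ≤ q * r * (s + 1) then d else 2 * d)

/-- The part of `comb` (shifted by `d`) that lies in the `s`-th period. -/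
def combPeriod (q r d s x : ℕ) : K :=
  if q * r * s < x ∧ x ≤ q * r * (s + 1) then comb q r (x + d) else 0

variable {q r d s x : ℕ}

theorem comb_mul_eq_one (hq : 0 < q) {a : ℕ} (ha : a % r ≠ 1) : comb (K := K) q r (q * a) = 1 := by
  rw [comb, if_pos ⟨dvd_mul_right q a, by rwa [Nat.mul_div_cancel_left _ hq]⟩]

theorem comb_mul_eq_zero (hq : 0 < q) {a : ℕ} (ha : a % r = 1) :
    comb (K := K) q r (q * a) = 0 := by
  rw [comb, if_neg]
  rintro ⟨-, h⟩
  exact h (by rwa [Nat.mul_div_cancel_left _ hq])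

theorem comb_eq_zero_of_lt {y a : ℕ} (h1 : q * a < y) (h2 : y < q * a + q) :
    comb (K := K) q r y = 0 := by
  rw [comb, if_neg]
  rintro ⟨⟨c, rfl⟩, -⟩
  have h3 : a < c := lt_of_mul_lt_mul_left h1 (Nat.zero_le q)
  have : q * (a + 1) ≤ q * c := Nat.mul_le_mul_left q h3
  rw [Nat.mul_succ] at this
  omega

theorem comb_add_period (hq : 0 < q) (y b : ℕ) :
    comb (K := K) q r (y + q * r * b) = comb q r y := by
  have h1 : q ∣ y + q * r * b ↔ q ∣ y := by
    rw [mul_assoc]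
    exact (Nat.dvd_add_iff_left (dvd_mul_right q _)).symm
  have h2 : (y + q * r * b) / q % r = y / q % r := by
    rw [mul_assoc, Nat.add_mul_div_left _ _ hq, Nat.add_mul_mod_self_left]
  simp only [comb, h1, h2]

theorem comb_eq_zero_of_gap (hr : 2 ≤ r) {y b : ℕ} (h1 : q * r * b < y)
    (h2 : y < q * r * b + 2 * q) : comb (K := K) q r y = 0 := by
  have hq : 0 < q := by omega
  rw [mul_assoc] at h1 h2
  rcases lt_trichotomy y (q * (r * b + 1)) with h | h | h
  · rw [Nat.mul_succ] at h
    exact comb_eq_zero_of_lt h1 h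
  · rw [h]
    refine comb_mul_eq_zero hq ?_
    rw [Nat.mul_add_mod, Nat.mod_eq_of_lt (by omega)]
  · exact comb_eq_zero_of_lt h (by rw [Nat.mul_succ]; omega)

theorem combPeriod_eq_zero_of_lt (hr : 2 ≤ r) (h : x + d < q * r * s + 2 * q) :
    combPeriod (K := K) q r d s x = 0 := by
  rw [combPeriod]
  split_ifs with h1
  · exact comb_eq_zero_of_gap hr (b := s) (by omega) h
  · rfl

theorem combPeriod_eq_zero_of_gt (hr : 2 ≤ r) (hd : d < 2 * q) (h : q * r * s + q * r < x + d) :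
    combPeriod (K := K) q r d s x = 0 := by
  rw [← Nat.mul_succ] at h
  rw [combPeriod]
  split_ifs with h1
  · exact comb_eq_zero_of_gap hr h (by have := h1.2; rw [Nat.succ_eq_add_one]; omega)
  · rfl

theorem combPeriod_eq_zero_of_not_dvd (h : ¬q ∣ x + d) : combPeriod (K := K) q r d s x = 0 := by
  have h1 : comb (K := K) q r (x + d) = 0 := if_neg fun h' => h h'.1
  rw [combPeriod, h1, ite_self]

theorem combPeriod_eq_one (hd : d < q) {i : ℕ} (hi1 : 2 ≤ i) (hi2 : i ≤ r)
    (h : x + d = q * r * s + q * i) : combPeriod (K := K) q r d s x = 1 := by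
  have h1 : q * 2 ≤ q * i := Nat.mul_le_mul_left q hi1
  have h2 : q * i ≤ q * r := Nat.mul_le_mul_left q hi2
  rw [combPeriod, if_pos ⟨by omega, by rw [Nat.mul_succ]; omega⟩, h, add_comm,
    comb_add_period (by omega)]
  refine comb_mul_eq_one (by omega) ?_
  rcases hi2.lt_or_eq with h3 | h3
  · rw [Nat.mod_eq_of_lt h3]
    omega
  · rw [h3, Nat.mod_self]
    exact zero_ne_one

theorem pattern_of_le (h : x ≤ q * r) : pattern (K := K) q r d s x = comb q r x := by
  rw [pattern, if_pos h, add_zero]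

theorem pattern_of_mid (h1 : q * r < x) (h2 : x ≤ q * r * (s + 1)) :
    pattern (K := K) q r d s x = comb q r (x + d) := by
  rw [pattern, if_neg (by omega), if_pos h2]

theorem pattern_of_gt (h : q * r * (s + 1) < x) :
    pattern (K := K) q r d s x = comb q r (x + 2 * d) := by
  have : q * r ≤ q * r * (s + 1) := Nat.le_mul_of_pos_right _ (by omega)
  rw [pattern, if_neg (by omega), if_neg (by omega)]

/-- Past the first period the model is periodic except across the second shift, so the difference
sees only the period just before that shift, once in its old position and once displaced by `d`. -/
theorem pattern_sub_pattern (hr : 2 ≤ r) (hd : d < q) (hx : q * r < x) :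
    pattern (K := K) q r d s x - pattern q r d s (x + q * r) =
      combPeriod q r d s x - combPeriod q r d s (x + d) := by
  have hq : 0 < q := by omega
  have hs1 : q * r * (s + 1) = q * r * s + q * r := Nat.mul_succ _ _
  have hper : ∀ y, comb (K := K) q r (y + q * r) = comb q r y := fun y => by
    simpa using comb_add_period (K := K) (r := r) hq y 1
  rcases lt_or_ge (q * r * (s + 1)) x with h1 | h1
  · rw [pattern_of_gt h1, pattern_of_gt (by omega), show x + q * r + 2 * d = x + 2 * d + q * r by
      ring, hper, combPeriod_eq_zero_of_gt hr (by omega) (by omega),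
      combPeriod_eq_zero_of_gt hr (by omega) (by omega), sub_self, sub_self]
  rw [pattern_of_mid hx h1]
  rcases lt_or_ge (q * r * s) x with h2 | h2
  · rw [pattern_of_gt (by omega), show x + q * r + 2 * d = x + 2 * d + q * r by ring, hper,
      combPeriod, if_pos ⟨h2, h1⟩]
    rcases lt_or_ge (q * r * (s + 1)) (x + d) with h3 | h3
    · rw [combPeriod_eq_zero_of_gt hr (by omega) (by omega),
        comb_eq_zero_of_gap hr (y := x + 2 * d) (b := s + 1) (by omega) (by omega)]
    · rw [combPeriod, if_pos ⟨by omega, h3⟩, show x + d + d = x + 2 * d by ring]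
  · rw [pattern_of_mid (by omega) (by omega), show x + q * r + d = x + d + q * r by ring, hper,
      combPeriod_eq_zero_of_lt hr (by omega), combPeriod_eq_zero_of_lt hr (by omega), sub_self,
      sub_self]

/-- The failure of skew-symmetry of the bracket of `e_{a+1}` and `e_{b+1}`. -/
def skewDefect (f : ℕ → K) (a b : ℕ) : K := iterDiff f (a + 1) b + iterDiff f (b + 1) a

theorem skewDefect_add (f g : ℕ → K) (a b : ℕ) :
    skewDefect (f + g) a b = skewDefect f a b + skewDefect g a b := by
  simp only [skewDefect, iterDiff_add]
  ring

theorem skewDefect_congr {f g : ℕ → K} {a b : ℕ} (h : ∀ x, 1 ≤ x → x ≤ a + b + 1 → f x = g x) :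
    skewDefect f a b = skewDefect g a b := by
  rw [skewDefect, skewDefect, iterDiff_congr fun x h1 h2 => h x (by omega) (by omega),
    iterDiff_congr (f := f) fun x h1 h2 => h x (by omega) (by omega)]

theorem IsAdmissible.skewDefect_eq_zero {ε : ℕ → K} (hε : IsAdmissible ε) (a b : ℕ) :
    skewDefect ε a b = 0 := by
  rw [skewDefect, hε.skew, neg_add_cancel]

theorem neg_one_pow_sub_of_odd {b e : ℕ} (he : Odd e) (h : e ≤ b) :
    (-1 : K) ^ (b - e) = -(-1) ^ b := by
  conv_rhs => rw [← Nat.sub_add_cancel h, pow_add, he.neg_one_pow]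
  ring

/-- The contribution of a single term whose distance to the end of the window is odd. -/
theorem skewDefect_single_of_odd {a b y e : ℕ} (c : K) (hy : y + e = a + b + 1) (hea : e ≤ a)
    (heb : e ≤ b) (he : Odd e) (hab : (-1 : K) ^ a = (-1) ^ b) :
    skewDefect (Pi.single y c) a b = -((-1) ^ b * ((a.choose e : K) + b.choose e) * c) := by
  rw [skewDefect, iterDiff_single c (by omega) (by omega), iterDiff_single c (by omega) (by omega),
    show y - (a + 1) = b - e by omega, show y - (b + 1) = a - e by omega, Nat.choose_symm heb,
    Nat.choose_symm hea, neg_one_pow_sub_of_odd he heb, neg_one_pow_sub_of_odd he hea, hab]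
  ring

theorem skewDefect_single_of_choose_eq_zero {a b y e : ℕ} (c : K) (hy : y + e = a + b + 1)
    (hea : e ≤ a) (heb : e ≤ b) (h1 : (a.choose e : K) = 0) (h2 : (b.choose e : K) = 0) :
    skewDefect (Pi.single y c) a b = 0 := by
  rw [skewDefect, iterDiff_single c (by omega) (by omega), iterDiff_single c (by omega) (by omega),
    show y - (a + 1) = b - e by omega, show y - (b + 1) = a - e by omega, Nat.choose_symm heb,
    Nat.choose_symm hea, h1, h2]
  ring

theorem skewDefect_single_last {a b y : ℕ} (c : K) (hy : y = a + b + 1)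
    (hab : (-1 : K) ^ a = (-1) ^ b) : skewDefect (Pi.single y c) a b = 2 * (-1) ^ b * c := by
  rw [skewDefect, iterDiff_single c (by omega) (by omega), iterDiff_single c (by omega) (by omega),
    show y - (a + 1) = b by omega, show y - (b + 1) = a by omega, Nat.choose_self,
    Nat.choose_self, hab]
  push_cast
  ring

variable (p : ℕ) [CharP K p]

/-- Operator form of `pattern_sub_pattern`: past the first period, `(1 - σ)^(q r)` of the model is
`(1 - σ)^d` of one period, `q r` and `d` being powers of `p`. -/
theorem iterDiff_pattern (hp : p.Prime) (hp2 : p ≠ 2) {n β : ℕ} (hr : 2 ≤ r) (hD : q * r = p ^ n)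
    (hd : d = p ^ β) (hdq : d < q) {m k : ℕ} (hm : q * r < m) :
    iterDiff (pattern (K := K) q r d s) m (q * r + k) =
      iterDiff (combPeriod q r d s) m (d + k) := by
  rw [← iterDiff_iterDiff, ← iterDiff_iterDiff]
  refine iterDiff_congr fun x hx _ => ?_
  rw [hD, hd, iterDiff_prime_pow p hp, iterDiff_prime_pow p hp, neg_one_pow_prime_pow hp hp2,
    neg_one_pow_prime_pow hp hp2, ← hD, ← hd]
  linear_combination pattern_sub_pattern (K := K) (s := s) hr hdq (show q * r < x by omega)

theorem skewDefect_pattern (hp : p.Prime) (hp2 : p ≠ 2) {n β : ℕ} (hr : 2 ≤ r)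
    (hD : q * r = p ^ n) (hd : d = p ^ β) (hdq : d < q) (a b : ℕ) :
    skewDefect (pattern (K := K) q r d s) (q * r + a) (q * r + b) =
      iterDiff (combPeriod q r d s) (q * r + a + 1) (d + b) +
      iterDiff (combPeriod q r d s) (q * r + b + 1) (d + a) := by
  rw [skewDefect, iterDiff_pattern p hp hp2 hr hD hd hdq (by omega),
    iterDiff_pattern p hp hp2 hr hD hd hdq (by omega)]

end Pattern

/-! ### Values of the defect of the model. -/

section Defect

variable {K : Type*} [Field K] (p : ℕ) [CharP K p] {q r d s n β : ℕ}

/-- In the periods `s + 1, s + 2, …` the pattern is skew-symmetric up to weight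
`q r (s + 1) + Q + 2q - 2d`. -/
theorem skewDefect_pattern_eq_zero (hp : p.Prime) (hp2 : p ≠ 2) (hr : 2 ≤ r) (hD : q * r = p ^ n)
    (hd : d = p ^ β) (hdq : d < q) {a b c v J Q N : ℕ} (hQ : Q = p ^ N) (hQD : q * r ≤ Q)
    (hs : q * r * s = Q * (c + 2)) (hb : b + d = q * r + Q)
    (ha : a + 1 + d = Q * (c + 1) + q * r * v + J) (hv : 1 ≤ v) (hJ : 1 ≤ J)
    (h : q * r * v + J < Q + 2 * q) : skewDefect (pattern (K := K) q r d s) a b = 0 := by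
  have hqD : q * 2 ≤ q * r := Nat.mul_le_mul_left q hr
  have e1 : Q * (c + 1) = Q * c + Q := Nat.mul_succ _ _
  have e2 : Q * (c + 2) = Q * c + Q + Q := by ring
  obtain ⟨v, rfl⟩ := Nat.exists_eq_add_of_le' hv
  have e3 : q * r * (v + 1) = q * r * v + q * r := Nat.mul_succ _ _
  obtain ⟨a, rfl⟩ := Nat.exists_eq_add_of_le (show q * r ≤ a by omega)
  obtain ⟨b, rfl⟩ := Nat.exists_eq_add_of_le (show q * r ≤ b by omega)
  -- As `d + b = Q` is a power of `p`, the first difference has two terms, one before and one after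
  -- the support. The second is cut into windows spaced by `Q`: those with `i ≤ c` end before the
  -- first tooth, and the one with `i = c + 1` starts past the last.
  rw [skewDefect_pattern p hp hp2 hr hD hd hdq, show d + b = p ^ N by omega,
    iterDiff_prime_pow p hp, combPeriod_eq_zero_of_lt hr (by omega),
    combPeriod_eq_zero_of_gt hr (by omega) (by omega), mul_zero, add_zero, zero_add,
    show d + a = p ^ N * (c + 1) + (q * r * v + J - 1) by rw [← hQ]; omega]
  have hdil := iterDiff_dilate (K := K) p hp hp2 (combPeriod q r d s) (q * r + b + 1) N
    (q * r * v + J - 1) 0 (c + 1)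
  rw [mul_zero, add_zero] at hdil
  rw [hdil, ← hQ]
  refine iterDiff_eq_zero fun i _ hi => iterDiff_eq_zero fun x hx1 hx2 => ?_
  rcases Nat.lt_or_ge c i with hic | hic
  · obtain rfl : i = c + 1 := by omega
    exact combPeriod_eq_zero_of_gt hr (by omega) (by omega)
  · have := Nat.mul_le_mul_left Q hic
    exact combPeriod_eq_zero_of_lt hr (by omega)

/-- At weight `q r (s + 1) + Q + 2q - 2d` skew-symmetry of the pattern fails. -/
theorem skewDefect_pattern_eq (hp : p.Prime) (hp2 : p ≠ 2) (hr : 2 ≤ r) (hD : q * r = p ^ n)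
    (hd : d = p ^ β) (hdq : d < q) {a b c Q N : ℕ} (hQ : Q = p ^ N) (hQD : q * r ≤ Q)
    (hs : q * r * s = Q * (c + 2)) (hc : Odd c) (hb : b + d = q * r + Q)
    (ha : a + 1 + d = Q * (c + 2) + 2 * q) :
    skewDefect (pattern (K := K) q r d s) a b = c + 2 := by
  have hqD : q * 2 ≤ q * r := Nat.mul_le_mul_left q hr
  have e1 : Q * (c + 1) = Q * c + Q := Nat.mul_succ _ _
  have e2 : Q * (c + 2) = Q * c + Q + Q := by ring
  obtain ⟨a, rfl⟩ := Nat.exists_eq_add_of_le (show q * r ≤ a by omega)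
  obtain ⟨b, rfl⟩ := Nat.exists_eq_add_of_le (show q * r ≤ b by omega)
  have hodd := hp.odd_of_ne_two hp2
  have hk : Odd (Q - q * r + 2 * q - 1) := by
    obtain ⟨x, hx⟩ : Odd Q := hQ ▸ hodd.pow
    obtain ⟨y, hy⟩ : Odd (q * r) := hD ▸ hodd.pow
    exact ⟨x - y + q - 1, by omega⟩
  rw [skewDefect_pattern p hp hp2 hr hD hd hdq, show d + b = p ^ N by omega,
    iterDiff_prime_pow p hp, combPeriod_eq_one hdq (i := 2) le_rfl hr (by omega),
    combPeriod_eq_zero_of_gt hr (by omega) (by omega), mul_zero, add_zero,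
    show d + a = p ^ N * (c + 1) + (Q - q * r + 2 * q - 1) by rw [← hQ]; omega]
  have hdil := iterDiff_dilate (K := K) p hp hp2 (combPeriod q r d s) (q * r + b + 1) N
    (Q - q * r + 2 * q - 1) 0 (c + 1)
  rw [mul_zero, add_zero] at hdil
  -- The first difference has contributed `1`, from the first tooth of the period. Of the windows
  -- spaced by `Q` only number `c` meets the support, with the same tooth as its last entry; since
  -- `c` and the order of the window are odd, it contributes `C(c + 1, c) = c + 1`.
  rw [hdil, ← hQ, iterDiff_eq_of_support (y := c) (by omega) (by omega)]
  · rw [iterDiff_eq_of_support (y := q * r * s + 2 * q - d) (by omega) (by omega)]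
    · rw [combPeriod_eq_one hdq (i := 2) le_rfl hr (by omega),
        show q * r * s + 2 * q - d - (q * r + b + 1 + Q * c) = Q - q * r + 2 * q - 1 by omega,
        Nat.choose_self, hk.neg_one_pow, Nat.sub_zero, hc.neg_one_pow, Nat.choose_succ_self_right]
      push_cast
      ring
    · intro x hx1 hx2 hx3
      exact combPeriod_eq_zero_of_lt hr (by omega)
  · intro i _ hi hne
    refine iterDiff_eq_zero fun x hx1 hx2 => ?_
    rcases Nat.lt_or_ge c i with hic | hic
    · obtain rfl : i = c + 1 := by omega
      exact combPeriod_eq_zero_of_gt hr (by omega) (by omega)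
    · obtain ⟨j, rfl⟩ := Nat.exists_eq_add_of_le (show i + 1 ≤ c by omega)
      have : Q * (i + 1 + j) = Q * i + Q + Q * j := by ring
      exact combPeriod_eq_zero_of_lt hr (by omega)

/-- Just after weight `q r (s + 1) + Q + 2q - 2d` the pattern is again skew-symmetric. -/
theorem skewDefect_pattern_eq_zero_after (hp : p.Prime) (hp2 : p ≠ 2) (hr : 3 ≤ r)
    (hD : q * r = p ^ n) (hd : d = p ^ β) (hdq : d < q) (hdvd : d ∣ q) {a b c e Q N : ℕ}
    (hQ : Q = p ^ N) (hQD : q * r ≤ Q) (hqQ : q ∣ Q)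
    (hs : q * r * s = Q * (c + 2)) (hb : b + d = q * r + Q)
    (ha : a + 1 + d = Q * (c + 2) + 2 * q + e) (he : 0 < e) (hed : e < d) :
    skewDefect (pattern (K := K) q r d s) a b = 0 := by
  have hqD : q * 3 ≤ q * r := Nat.mul_le_mul_left q hr
  have e1 : Q * (c + 1) = Q * c + Q := Nat.mul_succ _ _
  have e2 : Q * (c + 2) = Q * c + Q + Q := by ring
  obtain ⟨a, rfl⟩ := Nat.exists_eq_add_of_le (show q * r ≤ a by omega)
  obtain ⟨b, rfl⟩ := Nat.exists_eq_add_of_le (show q * r ≤ b by omega)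
  have hr2 : 2 ≤ r := by omega
  have hgap : ∀ x, x + d < q * r * s + 2 * q + q → x + d ≠ q * r * s + 2 * q →
      combPeriod (K := K) q r d s x = 0 := fun x h1 h2 => by
    rcases Nat.lt_or_ge (x + d) (q * r * s + 2 * q) with h3 | h3
    · exact combPeriod_eq_zero_of_lt hr2 h3
    · refine combPeriod_eq_zero_of_not_dvd fun h4 => ?_
      have h5 : q ∣ q * r * s + 2 * q := ⟨r * s + 2, by ring⟩
      have h6 := Nat.le_of_dvd (by omega) (Nat.dvd_sub h4 h5)
      omega
  rw [skewDefect_pattern p hp hp2 hr2 hD hd hdq, show d + b = p ^ N by omega,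
    iterDiff_prime_pow p hp, hgap _ (by omega) (by omega),
    combPeriod_eq_zero_of_gt hr2 (by omega) (by omega), mul_zero, add_zero, zero_add,
    show d + a = p ^ N * (c + 1) + (Q - q * r + 2 * q + (e - 1)) by rw [← hQ]; omega]
  have hdil := iterDiff_dilate (K := K) p hp hp2 (combPeriod q r d s) (q * r + b + 1) N
    (Q - q * r + 2 * q + (e - 1)) 0 (c + 1)
  rw [mul_zero, add_zero] at hdil
  rw [hdil, ← hQ]
  refine iterDiff_eq_zero fun i _ hi => ?_
  rcases lt_trichotomy i c with hic | hic | hic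
  · obtain ⟨j, rfl⟩ := Nat.exists_eq_add_of_le (show i + 1 ≤ c by omega)
    have : Q * (i + 1 + j) = Q * i + Q + Q * j := by ring
    exact iterDiff_eq_zero fun x hx1 hx2 => combPeriod_eq_zero_of_lt hr2 (by omega)
  · subst hic
    -- The first tooth lies `e` places before the end of this window. Its coefficient is, up to
    -- sign, `C(d g + (e - 1), e)`, which vanishes modulo `p` because `e - 1 < e < d`.
    rw [iterDiff_eq_of_support (y := q * r * s + 2 * q - d) (by omega) (by omega)]
    · obtain ⟨g, hg⟩ : d ∣ Q - q * r + 2 * q := by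
        refine dvd_trans hdvd (dvd_add (Nat.dvd_sub hqQ (dvd_mul_right q r)) (dvd_mul_left q 2))
      have h1 : q * r * s + 2 * q - d - (q * r + b + 1 + Q * i) =
          Q - q * r + 2 * q + (e - 1) - e := by omega
      rw [h1, Nat.choose_symm (by omega), hg, hd,
        choose_eq_zero_of_lt p hp hp2 (by omega) (by omega), mul_zero, zero_mul]
    · intro x hx1 hx2 hx3
      exact hgap x (by omega) (by omega)
  · obtain rfl : i = c + 1 := by omega
    exact iterDiff_eq_zero fun x hx1 hx2 => combPeriod_eq_zero_of_gt hr2 (by omega) (by omega)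

/-- In the first period after the second shift skew-symmetry of the pattern depends on the parity of
the number of periods. -/
theorem skewDefect_pattern_first (hp : p.Prime) (hp2 : p ≠ 2) {h k : ℕ} (hq : q = p ^ h)
    (hrk : r = p ^ k) (hr : 2 ≤ r) (hd : d = p ^ β) (hdq : d < q) {a b j : ℕ}
    (hj1 : 1 ≤ j) (hjr : j < r) (hb : b + d = q * r * (s + 1) + q * j)
    (ha : a + 1 + d = q * r + q) :
    skewDefect (pattern (K := K) q r d (s + 1)) a b = 1 - (-1) ^ s := by
  have hD : q * r = p ^ (h + k) := by rw [hq, hrk, pow_add]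
  have hqD : q * 2 ≤ q * r := Nat.mul_le_mul_left q hr
  have hqj : q * 1 ≤ q * j := Nat.mul_le_mul_left q hj1
  have hqj' : q * (j + 1) ≤ q * r := Nat.mul_le_mul_left q hjr
  have e0 : q * (j + 1) = q * j + q := Nat.mul_succ _ _
  have e1 : q * r * (s + 1) = q * r * s + q * r := Nat.mul_succ _ _
  obtain ⟨a, rfl⟩ := Nat.exists_eq_add_of_le (show q * r ≤ a by omega)
  obtain ⟨b, rfl⟩ := Nat.exists_eq_add_of_le (show q * r ≤ b by omega)
  rw [skewDefect_pattern p hp hp2 hr hD hd hdq]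
  have w : iterDiff (combPeriod (K := K) q r d (s + 1)) (q * r + b + 1) (d + a) = 1 := by
    rw [show d + a = p ^ h - 1 by omega,
      iterDiff_window_eq p hp (y := q * r * (s + 1) + q * (j + 1) - d) (by omega) (by omega)]
    · exact combPeriod_eq_one hdq (i := j + 1) (by omega) (by omega) (by omega)
    · intro x hx1 hx2 hx3
      refine combPeriod_eq_zero_of_not_dvd fun h4 => ?_
      have h5 : q ∣ q * r * (s + 1) + q * j := ⟨r * (s + 1) + j, by ring⟩
      have h6 := Nat.le_of_dvd (by omega) (Nat.dvd_sub h4 h5)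
      omega
  rw [w, show d + b = p ^ h * (r * s + j) + 0 by
    rw [← hq, add_zero, show q * (r * s + j) = q * r * s + q * j by ring]; omega]
  have hdil := iterDiff_dilate (K := K) p hp hp2 (combPeriod q r d (s + 1)) (q * r + a + 1) h
    0 0 (r * s + j)
  rw [mul_zero, add_zero] at hdil
  rw [hdil]
  -- The samples taken at distance `q` are differenced to order `r s + j`, which is dilated again by
  -- `r`. Only block `s` is nonzero; there the samples are `0, 1, …, 1`, whose difference of order
  -- `j ≥ 1` is `-1`.
  have hdil' := iterDiff_dilate (K := K) p hp hp2
    (fun i => iterDiff (combPeriod q r d (s + 1)) (q * r + a + 1 + p ^ h * i) 0) 0 k j 0 s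
  rw [mul_zero, add_zero, ← hrk, ← hq] at hdil'
  rw [← hq, hdil', iterDiff_eq_of_support (y := s) (by omega) (by omega)]
  · have h1 : iterDiff (fun i => iterDiff (combPeriod (K := K) q r d (s + 1))
        (q * r + a + 1 + q * i) 0) (0 + r * s) j =
        iterDiff ((fun _ => 1) + Pi.single (0 + r * s) (-1)) (0 + r * s) j := by
      refine iterDiff_congr fun x hx1 hx2 => ?_
      obtain ⟨y, rfl⟩ := Nat.exists_eq_add_of_le hx1
      have h2 : q * (0 + r * s + y) = q * r * s + q * y := by ring
      rw [iterDiff_zero]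
      rcases Nat.eq_zero_or_pos y with rfl | hy
      · have h3 : q * (0 + r * s) = q * r * s := by ring
        rw [add_zero, Pi.add_apply, Pi.single_eq_same, combPeriod_eq_zero_of_lt hr (by omega)]
        ring
      · rw [Pi.add_apply, Pi.single_eq_of_ne (by omega), add_zero]
        exact combPeriod_eq_one hdq (i := y + 1) (by omega) (by omega)
          (by rw [h2, show q * (y + 1) = q * y + q from Nat.mul_succ _ _]; omega)
    obtain ⟨j, rfl⟩ := Nat.exists_eq_add_of_le' hj1
    rw [h1, iterDiff_add, iterDiff_const, iterDiff_single _ le_rfl (by omega)]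
    simp
    ring
  · intro i _ hi hne
    refine iterDiff_eq_zero fun x hx1 hx2 => ?_
    obtain ⟨y, rfl⟩ := Nat.exists_eq_add_of_le hx1
    obtain ⟨t, rfl⟩ := Nat.exists_eq_add_of_le (show i + 1 ≤ s by omega)
    have h2 : q * (0 + r * i + y) = q * r * i + q * y := by ring
    have h3 : q * r * (i + 1 + t) = q * r * i + q * r + q * r * t := by ring
    have h4 : q * y ≤ q * j := Nat.mul_le_mul_left q (by omega)
    rw [iterDiff_zero]
    exact combPeriod_eq_zero_of_lt hr (by rw [h2]; omega)

/-- The companion of `skewDefect_pattern_first` for a weight larger by `d`, used when the term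
sought has even weight. After the shift by `d`, all sampled positions fall strictly between
multiples of `q`, so no tooth is met. -/
theorem skewDefect_pattern_first_shifted (hp : p.Prime) (hp2 : p ≠ 2) {h k : ℕ} (hq : q = p ^ h)
    (hrk : r = p ^ k) (hr : 2 ≤ r) (hd : d = p ^ β) (hdq : d < q) {a b j : ℕ}
    (hj1 : 1 ≤ j) (hb : b + d = q * r * (s + 1) + q * j)
    (ha : a + 1 = q * r + q) :
    skewDefect (pattern (K := K) q r d (s + 1)) a b = 0 := by
  have hD : q * r = p ^ (h + k) := by rw [hq, hrk, pow_add]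
  have hd0 : 0 < d := hd ▸ pow_pos hp.pos β
  have hqj : q * 1 ≤ q * j := Nat.mul_le_mul_left q hj1
  have e1 : q * r * (s + 1) = q * r * s + q * r := Nat.mul_succ _ _
  obtain ⟨a, rfl⟩ := Nat.exists_eq_add_of_le (show q * r ≤ a by omega)
  obtain ⟨b, rfl⟩ := Nat.exists_eq_add_of_le (show q * r ≤ b by omega)
  have hndvd : ∀ x g, q * g < x + d → x + d < q * g + q →
      combPeriod (K := K) q r d (s + 1) x = 0 := fun x g h1 h2 => by
    refine combPeriod_eq_zero_of_not_dvd fun h4 => ?_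
    have h6 := Nat.le_of_dvd (by omega) (Nat.dvd_sub h4 (dvd_mul_right q g))
    omega
  rw [skewDefect_pattern p hp hp2 hr hD hd hdq]
  have w : iterDiff (combPeriod (K := K) q r d (s + 1)) (q * r + b + 1) (d + a) = 0 := by
    have h1 : q * (r * (s + 1) + j) = q * r * (s + 1) + q * j := by ring
    have h2 : q * (r * (s + 1) + j + 1) = q * r * (s + 1) + q * j + q := by ring
    rw [show d + a = p ^ h + (d - 1) by omega, iterDiff_prime_pow_add p hp hp2, ← hq,
      iterDiff_eq_zero fun x hx1 hx2 => hndvd x _ (by rw [h1]; omega) (by rw [h1]; omega),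
      iterDiff_eq_zero fun x hx1 hx2 => hndvd x _ (by rw [h2]; omega) (by rw [h2]; omega),
      sub_zero]
  rw [w, add_zero, show d + b = p ^ h * (r * s + j) + 0 by
    rw [← hq, add_zero, show q * (r * s + j) = q * r * s + q * j by ring]; omega]
  have hdil := iterDiff_dilate (K := K) p hp hp2 (combPeriod q r d (s + 1)) (q * r + a + 1) h
    0 0 (r * s + j)
  rw [mul_zero, add_zero] at hdil
  rw [hdil, ← hq]
  refine iterDiff_eq_zero fun i _ hi => ?_
  rw [iterDiff_zero]
  have h3 : q * (r + 1 + i) = q * r + q + q * i := by ring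
  exact hndvd _ (r + 1 + i) (by rw [h3]; omega) (by rw [h3]; omega)

end Defect

/-! ### Recovering a single term from skew-symmetry. -/

section Deviation

variable {K : Type*} [Field K]

theorem neg_one_pow_congr {a b : ℕ} (h : Even (a + b)) : (-1 : K) ^ a = (-1) ^ b := by
  rw [neg_one_pow_eq_pow_mod_two, neg_one_pow_eq_pow_mod_two (n := b)]
  rw [Nat.even_iff] at h
  congr 1
  omega

/-- If `ε` agrees with `g` before an odd weight `i`, and `g` is skew-symmetric at weight `i`, then
they agree in weight `i`. -/
theorem IsAdmissible.eq_of_odd {ε g : ℕ → K} (hε : IsAdmissible ε) (h2 : (2 : K) ≠ 0) {i a b : ℕ}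
    (hagree : ∀ x, 1 ≤ x → x < i → ε x = g x) (hi : i = a + b + 1) (hodd : Odd i)
    (hg : skewDefect g a b = 0) : ε i = g i := by
  have h1 : skewDefect ε a b = skewDefect (g + Pi.single i (ε i - g i)) a b := by
    refine skewDefect_congr fun x hx1 hx2 => ?_
    rw [Pi.add_apply]
    rcases eq_or_ne x i with rfl | hx
    · rw [Pi.single_eq_same]
      ring
    · rw [Pi.single_eq_of_ne hx, add_zero]
      exact hagree x hx1 (by omega)
  -- The last weight enters the defect with coefficient `(-1)^a + (-1)^b`, which is `±2` because `i`
  -- odd gives `a` and `b` the same parity. For even `i` it would be `0`, whence the detour through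
  -- weight `i + d` in the even case.
  rw [hε.skewDefect_eq_zero, skewDefect_add, hg, zero_add, skewDefect_single_last _ hi] at h1
  · have h3 := (mul_eq_zero.1 h1.symm).resolve_left
      (mul_ne_zero h2 (pow_ne_zero _ (neg_ne_zero.2 one_ne_zero)))
    exact sub_eq_zero.1 h3
  · refine neg_one_pow_congr ?_
    rw [hi, Nat.odd_add_one] at hodd
    exact Nat.not_odd_iff_even.1 hodd

/-- If `ε` agrees with `g` before an even weight `i` and in the weights `i + 1, …, i + d`, with `d`
odd, and `g` is skew-symmetric at weight `i + d`, then they agree in weight `i`. -/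
theorem IsAdmissible.eq_of_even {ε g : ℕ → K} (hε : IsAdmissible ε) (h2 : (2 : K) ≠ 0)
    {i d a b : ℕ} (hagree : ∀ x, 1 ≤ x → x < i → ε x = g x)
    (hagree' : ∀ x, i < x → x ≤ i + d → ε x = g x) (hi : i + d = a + b + 1) (heven : Even i)
    (hd : Odd d) (hda : d ≤ a) (hdb : d ≤ b) (hg : skewDefect g a b = 0)
    (hchoose : (a.choose d : K) + b.choose d = -2) : ε i = g i := by
  have h1 : skewDefect ε a b = skewDefect (g + Pi.single i (ε i - g i)) a b := by
    refine skewDefect_congr fun x hx1 hx2 => ?_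
    rw [Pi.add_apply]
    rcases lt_trichotomy x i with hx | rfl | hx
    · rw [Pi.single_eq_of_ne hx.ne, add_zero]
      exact hagree x hx1 hx
    · rw [Pi.single_eq_same]
      ring
    · rw [Pi.single_eq_of_ne hx.ne', add_zero]
      exact hagree' x hx (by omega)
  have hab : Even (a + b) := by
    have := heven.add_odd hd
    rw [hi, Nat.odd_add_one] at this
    exact Nat.not_odd_iff_even.1 this
  rw [hε.skewDefect_eq_zero, skewDefect_add, hg, zero_add,
    skewDefect_single_of_odd _ hi hda hdb hd (neg_one_pow_congr hab), hchoose] at h1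
  have h3 : (-1 : K) ^ b * 2 * (ε i - g i) = 0 := by linear_combination -h1
  have h4 := (mul_eq_zero.1 h3).resolve_left
    (mul_ne_zero (pow_ne_zero _ (neg_ne_zero.2 one_ne_zero)) h2)
  exact sub_eq_zero.1 h4

end Deviation

/-! ### The setting of the contradiction. -/

section Contradiction

variable {K : Type*} [Field K]

/-- The situation to be excluded: the sequence `ε` starts like `pattern q r d s`, where
`s = p ^ l * (c + 2)` with `c + 2` prime to `p`. -/
structure StartsLikePattern (p h k β l c q r d s Q : ℕ) (ε : ℕ → K) : Prop where
  prime : p.Prime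
  ne_two : p ≠ 2
  charP : CharP K p
  q_eq : q = p ^ h
  r_eq : r = p ^ k
  d_eq : d = p ^ β
  s_eq : s = p ^ l * (c + 2)
  Q_eq : Q = q * r * p ^ l
  k_pos : 1 ≤ k
  β_lt : β < h
  not_dvd : ¬p ∣ c + 2
  adm : IsAdmissible ε
  agree : ∀ x, 1 ≤ x → x + 2 * d ≤ q * r * (s + 1) + 2 * q → ε x = pattern q r d s x

namespace StartsLikePattern

variable {p h k β l c q r d s Q : ℕ} {ε : ℕ → K}
  (H : StartsLikePattern p h k β l c q r d s Q ε)
include H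

theorem three_le_p : 3 ≤ p := by
  have := H.prime.two_le
  have := H.ne_two
  omega

theorem two_ne_zero' : (2 : K) ≠ 0 := by
  have := H.charP
  intro h0
  have h1 : ((2 : ℕ) : K) = 0 := by exact_mod_cast h0
  rw [CharP.cast_eq_zero_iff K p] at h1
  have := Nat.le_of_dvd (by omega) h1
  have := H.three_le_p
  omega

theorem d_pos : 0 < d := H.d_eq ▸ pow_pos H.prime.pos β

theorem d_odd : Odd d := H.d_eq ▸ (H.prime.odd_of_ne_two H.ne_two).pow

theorem three_mul_pow_le {t : ℕ} (ht : t < h) : 3 * p ^ t ≤ q := by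
  rw [H.q_eq]
  calc 3 * p ^ t ≤ p * p ^ t := Nat.mul_le_mul_right _ H.three_le_p
    _ = p ^ (t + 1) := by ring
    _ ≤ p ^ h := Nat.pow_le_pow_right H.prime.pos ht

theorem three_mul_d_le : 3 * d ≤ q := H.d_eq ▸ H.three_mul_pow_le H.β_lt

theorem three_le_r : 3 ≤ r := by
  rw [H.r_eq]
  exact H.three_le_p.trans (Nat.le_self_pow (by have := H.k_pos; omega) p)

theorem three_mul_q_le : 3 * q ≤ q * r := by
  rw [mul_comm]
  exact Nat.mul_le_mul_left q H.three_le_r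

theorem qr_eq : q * r = p ^ (h + k) := by rw [H.q_eq, H.r_eq, pow_add]

theorem Q_eq_pow : Q = p ^ (h + k + l) := by rw [H.Q_eq, H.qr_eq, ← pow_add]

theorem qr_le_Q : q * r ≤ Q := by
  rw [H.Q_eq]
  exact Nat.le_mul_of_pos_right _ (pow_pos H.prime.pos l)

theorem qr_mul_s : q * r * s = Q * (c + 2) := by rw [H.s_eq, H.Q_eq]; ring

theorem dvd_q : d * p ∣ q := by
  rw [H.d_eq, H.q_eq, ← pow_succ]
  exact pow_dvd_pow p H.β_lt

theorem dvd_Q : q ∣ Q := by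
  rw [H.Q_eq, mul_assoc]
  exact dvd_mul_right q _

/-- Adding `m` to the digit of `a` at `d = p^β` clears it modulo `p`, so that digit is `-m`. -/
theorem choose_eq {a w e m : ℕ} (hw : d * p ∣ w) (he : e < d) (h : a + m * d = w + e) :
    (a.choose d : K) = -(m : K) := by
  have := H.charP
  obtain ⟨g, rfl⟩ := hw
  rw [H.d_eq] at he h ⊢
  exact choose_prime_pow_eq_neg p H.prime (w := g) he (by rw [h, mul_assoc])

theorem small {x : ℕ} (h1 : 1 ≤ x) (h2 : x < 2 * q) : ε x = 0 := by
  have h3 := H.three_mul_q_le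
  have h4 := H.three_mul_d_le
  have h5 : q * r * (s + 1) = q * r * s + q * r := Nat.mul_succ _ _
  rw [H.agree x h1 (by omega), pattern_of_le (by omega)]
  exact comb_eq_zero_of_gap (b := 0) (by have := H.three_le_r; omega) (by omega) (by omega)

theorem eq_one_mul {a : ℕ} (ha1 : 2 ≤ a) (ha2 : a ≤ 3) : ε (a * q) = 1 := by
  have h3 := H.three_mul_q_le
  have h4 := H.three_mul_d_le
  have h5 : q * r * (s + 1) = q * r * s + q * r := Nat.mul_succ _ _
  have h6 : a * q ≤ 3 * q := Nat.mul_le_mul_right q ha2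
  have h7 : 2 * q ≤ a * q := Nat.mul_le_mul_right q ha1
  have hr := H.three_le_r
  have hd := H.d_pos
  rw [H.agree _ (by omega) (by omega), pattern_of_le (by omega), mul_comm]
  refine comb_mul_eq_one (by omega) ?_
  rcases (show a ≤ r by omega).lt_or_eq with h8 | h8
  · rw [Nat.mod_eq_of_lt h8]
    omega
  · rw [h8, Nat.mod_self]
    exact zero_ne_one

theorem zero_after {N : ℕ} (hN1 : 1 ≤ N) (hN : ε N ≠ 0)
    (hz : ∀ x, N < x + q → x < N → ε x = 0) : ∀ x, N < x → x < N + q → ε x = 0 := by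
  have := H.charP
  rw [H.q_eq] at hz ⊢
  exact H.adm.zero_after H.prime (fun x h1 h2 => H.small h1 (H.q_eq ▸ h2)) hN1 hN hz

theorem gap_length {N j : ℕ} (hN1 : 1 ≤ N) (hN : ε N ≠ 0)
    (hz : ∀ x, N < x + q → x < N → ε x = 0) (hz' : ∀ x, N < x → x < N + j → ε x = 0)
    (hj1 : q < j) (hj2 : j < 2 * q) (hj : ε (N + j) ≠ 0) : ∃ t, t < h ∧ j + p ^ t = 2 * q := by
  have := H.charP
  rw [H.q_eq] at hz hj1 hj2 ⊢
  exact H.adm.gap_length H.prime (fun x h1 h2 => H.small h1 (H.q_eq ▸ h2)) hN1 hN hz hz' hj1 hj2 hj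

theorem one_of_full_gap {N : ℕ} (hN1 : 1 ≤ N) (hN : ε N = 1)
    (hz : ∀ x, N < x → x < N + 2 * q → ε x = 0) : ε (N + 2 * q) = 1 := by
  have := H.charP
  have h2q := H.eq_one_mul (a := 2) le_rfl (by omega)
  rw [H.q_eq] at hz h2q ⊢
  exact H.adm.one_of_full_gap H.prime H.ne_two h2q hN1 hN hz

theorem eq_one_of_short_gap {N i : ℕ} (hN1 : 1 ≤ N) (hN : ε N = 1)
    (hi : i + d = N + 2 * q) (hi0 : ε i ≠ 0) (hz : ∀ x, N < x + q → x < N → ε x = 0)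
    (hz' : ∀ x, N < x → x < i → ε x = 0) : ε i = 1 ∧ ε (i + q) = 1 := by
  have := H.charP
  have h2q := H.eq_one_mul (a := 2) le_rfl (by omega)
  have h3q := H.eq_one_mul (a := 3) (by omega) le_rfl
  have h3 := H.three_mul_d_le
  have h4 := H.d_pos
  have h5 : ∀ x, 1 ≤ x → x < 2 * q → ε x = 0 := fun x h1 h2 => H.small h1 h2
  rw [H.q_eq] at hz h2q h3q hi h3 h5 ⊢
  exact H.adm.eq_one_of_short_gap H.prime H.ne_two h5 h2q h3q hN1 hN h4 (by omega) hi hi0 hz hz'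

/-- The number of periods before the second shift is odd. -/
theorem odd_c : Odd c := by
  have := H.charP
  have hr := H.three_le_r
  have hd := H.three_mul_d_le
  have hd0 := H.d_pos
  obtain ⟨s', hs'⟩ : ∃ s', s = s' + 1 := Nat.exists_eq_add_of_le' (by
    rw [H.s_eq]
    exact Nat.mul_pos (pow_pos H.prime.pos l) (by omega))
  have e1 : q * r * (s + 1) = q * r * s + q * r := Nat.mul_succ _ _
  -- The weight is the last one of known agreement, where the second gap `2q - d` closes. The defect
  -- `1 - (-1)^(s-1)` must vanish there, so `s` is odd.
  have h1 := skewDefect_pattern_first (K := K) p H.prime H.ne_two (s := s') H.q_eq H.r_eq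
    (by omega) H.d_eq (by omega) (a := q * r + q - d - 1) (b := q * r * (s' + 1) + q * 1 - d)
    le_rfl (by omega) (by omega) (by omega)
  rw [← hs', ← skewDefect_congr fun x hx1 hx2 => H.agree x hx1 (by omega),
    H.adm.skewDefect_eq_zero] at h1
  have h2 : Even s' := by
    rcases Nat.even_or_odd s' with h3 | h3
    · exact h3
    · rw [h3.neg_one_pow] at h1
      exact absurd (by linear_combination -h1) H.two_ne_zero'
  have h4 : Odd s := hs' ▸ h2.add_one
  rw [H.s_eq, Nat.odd_mul] at h4
  have h5 := h4.2
  rw [Nat.odd_add] at h5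
  exact h5.2 even_two

end StartsLikePattern

end Contradiction

/-! ### No premature term at the end of a period. -/

namespace StartsLikePattern

variable {K : Type*} [Field K] {p h k β l c q r d s Q : ℕ} {ε : ℕ → K}
  (H : StartsLikePattern p h k β l c q r d s Q ε)
include H

/-- A third shift immediately after `p ^ l` periods is not compatible with the Jacobi identity. -/
theorem false_of_third_shift {i : ℕ} (hi : i + 3 * d = q * r * (s + 1) + Q + 2 * q)
    (hagree : ∀ x, 1 ≤ x → x < i → ε x = pattern q r d s x)
    (hz : ∀ x, i < x → x < i + q → ε x = 0) (hlast : ε (i + q) = 1) (hc : ((c + 2 : ℕ) : K) = 1) :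
    False := by
  have := H.charP
  have hr := H.three_le_r
  have hd := H.three_mul_d_le
  have hd0 := H.d_pos
  have hqr := H.three_mul_q_le
  have hQ := H.qr_le_Q
  have hs := H.qr_mul_s
  have e1 : q * r * (s + 1) = q * r * s + q * r := Nat.mul_succ _ _
  have e2 : Q * (c + 2) = Q * c + Q + Q := by ring
  have hq0 : 0 < q := by omega
  -- Chosen so that `m + k' = i + q`, `ε m = ε k' = 0` and `k' - 1 = Q (c + 2) + (q - d - 1)`.
  obtain ⟨m, hm⟩ : ∃ m, m + 2 * d = q * r + Q + 2 * q := ⟨q * r + Q + 2 * q - 2 * d, by omega⟩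
  obtain ⟨k', hk'⟩ : ∃ k', k' + d = q * r * s + q := ⟨q * r * s + q - d, by omega⟩
  have hm0 : ε m = 0 := by
    rw [hagree m (by omega) (by omega), pattern_of_mid (by omega) (by omega)]
    have e3 : q * (r + r * p ^ l + 1) = q * r + Q + q := by rw [H.Q_eq]; ring
    exact comb_eq_zero_of_lt (a := r + r * p ^ l + 1) (by omega) (by omega)
  have hk0 : ε k' = 0 := by
    rw [hagree k' (by omega) (by omega), pattern_of_mid (by omega) (by omega)]
    exact comb_eq_zero_of_gap (b := s) (by omega) (by omega) (by omega)
  have hbin : ((q - d - 1).choose d : K) = -2 := by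
    have := H.choose_eq (a := q - d - 1) (m := 2) (w := q) (e := d - 1) H.dvd_q (by omega)
      (by omega)
    simpa using this
  have key : iterDiff ε m (k' - 1) = 1 := by
    have hdil := iterDiff_dilate (K := K) p H.prime H.ne_two ε m (h + k + l) (q - d - 1) 0 (c + 2)
    rw [mul_zero, add_zero, ← H.Q_eq_pow] at hdil
    rw [show k' - 1 = Q * (c + 2) + (q - d - 1) by omega, hdil]
    -- The window from `m + Q j` has its tooth at offset `d` for `j ≤ c` (value `-C(q - d - 1, d) =
    -- 2`), at offset `0` for `j = c + 1`, past the second shift (value `1`), and none for `j = c +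
    -- 2`, where the third shift has moved it in front of the window. As `c` is odd, the difference
    -- of order `c + 2` of `2, …, 2, 1, 0` is `-(c + 2) + 2 = 1`.
    have hf : iterDiff (fun j => iterDiff ε (m + Q * j) (q - d - 1)) 0 (c + 2) =
        iterDiff (((fun _ => (2 : K)) + Pi.single (c + 1) (-1)) + Pi.single (c + 2) (-2))
          0 (c + 2) := by
      refine iterDiff_congr fun j _ hj => ?_
      rw [Pi.add_apply, Pi.add_apply]
      rcases lt_trichotomy j (c + 1) with hjc | rfl | hjc
      · rw [Pi.single_eq_of_ne (by omega), Pi.single_eq_of_ne (by omega), add_zero, add_zero]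
        have hj' : Q * j ≤ Q * c := Nat.mul_le_mul_left Q (by omega)
        have e3 : q * (r + r * p ^ l + r * p ^ l * j + 2) = q * r + Q + Q * j + 2 * q := by
          rw [H.Q_eq]; ring
        have e4 : q * (r + r * p ^ l + r * p ^ l * j + 1) = q * r + Q + Q * j + q := by
          rw [H.Q_eq]; ring
        rw [iterDiff_eq_of_support (y := m + Q * j + d) (by omega) (by omega)]
        · rw [Nat.add_sub_cancel_left, H.d_odd.neg_one_pow, hbin, hagree _ (by omega) (by omega),
            pattern_of_mid (by omega) (by omega),
            show m + Q * j + d + d = q * (2 + r * (1 + p ^ l + p ^ l * j)) by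
              rw [show q * (2 + r * (1 + p ^ l + p ^ l * j)) = q * r + Q + Q * j + 2 * q by
                rw [H.Q_eq]; ring]
              omega,
            comb_mul_eq_one hq0 (by
              rw [Nat.add_mul_mod_self_left, Nat.mod_eq_of_lt (by omega)]; omega)]
          ring
        · intro x hx1 hx2 hx3
          rw [hagree x (by omega) (by omega), pattern_of_mid (by omega) (by omega)]
          rcases Nat.lt_or_ge (x + d) (q * (r + r * p ^ l + r * p ^ l * j + 2)) with hlt | hge
          · exact comb_eq_zero_of_lt (a := r + r * p ^ l + r * p ^ l * j + 1) (by omega) (by omega)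
          · exact comb_eq_zero_of_lt (a := r + r * p ^ l + r * p ^ l * j + 2) (by omega) (by omega)
      · have e3 : Q * (c + 1) = Q * c + Q := Nat.mul_succ _ _
        rw [Pi.single_eq_same, Pi.single_eq_of_ne (by omega), add_zero,
          iterDiff_eq_of_support (y := m + Q * (c + 1)) (by omega) (by omega)]
        · rw [Nat.sub_self, pow_zero, Nat.choose_zero_right, hagree _ (by omega) (by omega),
            pattern_of_gt (by omega), show m + Q * (c + 1) + 2 * d = q * 2 + q * r * (s + 1) by
              omega, comb_add_period hq0,
            comb_mul_eq_one hq0 (by rw [Nat.mod_eq_of_lt (by omega)]; omega)]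
          push_cast
          ring
        · intro x hx1 hx2 hx3
          have e4 : q * (r * (s + 1) + 2) = q * r * (s + 1) + 2 * q := by ring
          rw [hagree x (by omega) (by omega), pattern_of_gt (by omega)]
          exact comb_eq_zero_of_lt (a := r * (s + 1) + 2) (by omega) (by omega)
      · obtain rfl : j = c + 2 := by omega
        rw [Pi.single_eq_same, Pi.single_eq_of_ne (by omega),
          iterDiff_eq_zero fun x hx1 hx2 => hz x (by omega) (by omega)]
        ring
    have hc1 : (-1 : K) ^ (c + 1) = 1 := H.odd_c.add_one.neg_one_pow
    have hc2 : (-1 : K) ^ (c + 2) = -1 := (H.odd_c.add_even even_two).neg_one_pow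
    rw [hf, iterDiff_add, iterDiff_add, iterDiff_const, iterDiff_single _ (by omega) (by omega),
      iterDiff_single _ (by omega) (by omega), Nat.sub_zero, Nat.sub_zero, Nat.choose_self,
      Nat.choose_succ_self_right, hc1, hc2]
    push_cast at hc ⊢
    linear_combination -hc
  have h0 := H.adm.eq_zero_of_zero_zero (m := m) (k := k') (by omega) (by omega) hm0 hk0
    (by rw [key]; exact one_ne_zero)
  rw [show m + k' = i + q by omega, hlast] at h0
  exact one_ne_zero h0

/-- A nonzero term in a gap of length `2q` between two periods is impossible. -/
theorem eq_zero_of_end {N i v t : ℕ} (hv : 1 ≤ v) (hvQ : v ≤ p ^ l) (ht : t ≤ h)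
    (hN : N + 2 * d = q * r * (s + 1 + v)) (hi : i + p ^ t = N + 2 * q)
    (hagree : ∀ x, 1 ≤ x → x < i → ε x = pattern q r d s x) : ε i = 0 := by
  have := H.charP
  have hr := H.three_le_r
  have hr2 : 2 ≤ r := by omega
  have hd := H.three_mul_d_le
  have hd0 := H.d_pos
  have hqr := H.three_mul_q_le
  have hQ := H.qr_le_Q
  have hs := H.qr_mul_s
  have e1 : q * r * (s + 1) = q * r * s + q * r := Nat.mul_succ _ _
  have e1' : q * r * (s + 1 + v) = q * r * s + q * r + q * r * v := by ring
  have e2 : Q * (c + 2) = Q * c + Q + Q := by ring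
  have e3 : Q * (c + 1) = Q * c + Q := Nat.mul_succ _ _
  have e4 : q * r * 1 ≤ q * r * v := Nat.mul_le_mul_left _ hv
  have e5 : q * r * v ≤ Q := H.Q_eq ▸ Nat.mul_le_mul_left _ hvQ
  have e6 : v = p ^ l ∨ q * r * v + q * r ≤ Q := by
    rcases hvQ.lt_or_eq with h1 | h1
    · right
      rw [H.Q_eq, ← Nat.mul_succ]
      exact Nat.mul_le_mul_left _ h1
    · exact Or.inl h1
  have hq0 : 0 < q := by omega
  have hpt : 0 < p ^ t := pow_pos H.prime.pos t
  have hptq : p ^ t ≤ q := H.q_eq ▸ Nat.pow_le_pow_right H.prime.pos ht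
  have hzero : ∀ x, N < x → x < N + 2 * q → pattern (K := K) q r d s x = 0 := fun x h1 h2 => by
    rw [pattern_of_gt (by omega)]
    exact comb_eq_zero_of_gap hr2 (b := s + 1 + v) (by omega) (by omega)
  have hN1 : ε N = 1 := by
    rw [hagree N (by omega) (by omega), pattern_of_gt (by omega), hN,
      show q * r * (s + 1 + v) = q * (r * (s + 1 + v)) by ring]
    exact comb_mul_eq_one hq0 (by rw [Nat.mul_mod_right]; exact zero_ne_one)
  have hbefore : ∀ x, N < x + q → x < N → ε x = 0 := fun x h1 h2 => by
    rw [hagree x (by omega) (by omega), pattern_of_gt (by omega)]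
    obtain ⟨g, hg⟩ : ∃ g, q * g + q = q * r * (s + 1 + v) := by
      refine ⟨r * (s + 1 + v) - 1, ?_⟩
      rw [← Nat.mul_succ, Nat.succ_eq_add_one, Nat.sub_add_cancel, mul_assoc]
      exact Nat.mul_pos (by omega) (by omega)
    exact comb_eq_zero_of_lt (a := g) (by omega) (by omega)
  by_contra hi0
  have hafter := H.zero_after (N := i) (by omega) hi0 fun x h1 h2 => by
    rw [hagree x (by omega) h2, hzero x (by omega) (by omega)]
  have hpi : pattern (K := K) q r d s i = 0 := hzero i (by omega) (by omega)
  obtain ⟨b, hb⟩ : ∃ b, b + d = q * r + Q := ⟨q * r + Q - d, by omega⟩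
  have hvan : ∀ a J, a + 1 + d = Q * (c + 1) + q * r * v + J → 1 ≤ J →
      q * r * v + J < Q + 2 * q → skewDefect (pattern (K := K) q r d s) a b = 0 :=
    fun a J ha hJ hlt => skewDefect_pattern_eq_zero p H.prime H.ne_two hr2 H.qr_eq H.d_eq
      (by omega) H.Q_eq_pow hQ hs hb ha hv hJ hlt
  have hbdvd : d * p ∣ q * r + Q := dvd_add (H.dvd_q.mul_right r) (H.dvd_q.trans H.dvd_Q)
  have hbchoose : (b.choose d : K) = -1 := by
    simpa using H.choose_eq (a := b) (m := 1) (e := 0) hbdvd hd0 (by omega)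
  rcases Nat.even_or_odd i with heven | hodd
  swap
  · refine hi0 ((H.adm.eq_of_odd H.two_ne_zero' (a := Q * (c + 1) + q * r * v + (2 * q - p ^ t)
      - d - 1) (b := b) hagree (by omega) hodd ?_).trans hpi)
    exact hvan _ (2 * q - p ^ t) (by omega) (by omega) (by omega)
  obtain ⟨a, ha⟩ : ∃ a, a + 1 + p ^ t = Q * (c + 1) + q * r * v + 2 * q :=
    ⟨Q * (c + 1) + q * r * v + 2 * q - p ^ t - 1, by omega⟩
  have hW : d * p ∣ Q * (c + 1) + q * r * v + 2 * q :=
    dvd_add (dvd_add ((H.dvd_q.trans H.dvd_Q).mul_right _) ((H.dvd_q.mul_right r).mul_right v))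
      (H.dvd_q.mul_left 2)
  -- For even `i` the test weight is `i + d`. If `p^t > d`, it precedes the next tooth `N + 2q` of
  -- the model, so only the term at `i` can deviate.
  rcases Nat.lt_or_ge β t with hβt | hβt
  · have hdt : d * p ∣ p ^ t := by
      rw [H.d_eq, ← pow_succ]
      exact pow_dvd_pow p hβt
    have hlt : d < p ^ t := by
      rw [H.d_eq]
      exact Nat.pow_lt_pow_right H.prime.one_lt hβt
    refine hi0 ((H.adm.eq_of_even H.two_ne_zero' (a := a) (b := b) (d := d) hagree
      (fun x h1 h2 => ?_) (by omega) heven H.d_odd (by omega) (by omega) ?_ ?_).trans hpi)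
    · rw [hafter x h1 (by omega), hzero x (by omega) (by omega)]
    · exact hvan a (2 * q - p ^ t + d) (by omega) (by omega) (by omega)
    · have h1 := H.choose_eq (a := a) (m := 1) (e := d - 1) (Nat.dvd_sub hW hdt) (by omega)
        (by omega)
      rw [h1, hbchoose]
      push_cast
      ring
  have hptd : p ^ t ≤ d := H.d_eq ▸ Nat.pow_le_pow_right H.prime.pos hβt
  have hab : (-1 : K) ^ a = (-1) ^ b := by
    refine neg_one_pow_congr ?_
    have h1 := heven.add_odd H.d_odd
    rw [show i + d = a + b + 1 by omega, Nat.odd_add_one] at h1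
    exact Nat.not_odd_iff_even.1 h1
  have hbodd : (-1 : K) ^ b = -1 := by
    have hodd := H.prime.odd_of_ne_two H.ne_two
    have h1 : Even (q * r + Q) := by
      rw [H.qr_eq, H.Q_eq_pow]
      exact hodd.pow.add_odd hodd.pow
    rw [← hb, Nat.even_add] at h1
    refine Odd.neg_one_pow (Nat.not_even_iff_odd.1 fun h2 => ?_)
    exact Nat.not_even_iff_odd.2 H.d_odd (h1.1 h2)
  -- Now `p^t ≤ d`, so the window reaches `N + 2q = i + p^t`, where the model has a tooth and `ε` a
  -- zero: hence the correction `-1`.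
  have hexp : skewDefect ε a b = skewDefect ((pattern q r d s + Pi.single i (ε i)) +
      Pi.single (i + p ^ t) (-1)) a b := by
    refine skewDefect_congr fun x hx1 hx2 => ?_
    rw [Pi.add_apply, Pi.add_apply]
    rcases lt_trichotomy x i with hx | rfl | hx
    · rw [Pi.single_eq_of_ne (by omega), Pi.single_eq_of_ne (by omega), hagree x hx1 hx]
      ring
    · rw [Pi.single_eq_same, Pi.single_eq_of_ne (by omega), hpi]
      ring
    · rw [Pi.single_eq_of_ne (by omega), hafter x hx (by omega)]
      rcases lt_trichotomy x (i + p ^ t) with hx' | rfl | hx'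
      · rw [Pi.single_eq_of_ne (by omega), hzero x (by omega) (by omega)]
        ring
      · rw [Pi.single_eq_same, pattern_of_gt (by omega),
          show i + p ^ t + 2 * d = q * 2 + q * r * (s + 1 + v) by omega, comb_add_period hq0,
          comb_mul_eq_one hq0 (by rw [Nat.mod_eq_of_lt (by omega)]; omega)]
        ring
      · have e7 : q * (r * (s + 1 + v) + 2) = q * r * (s + 1 + v) + 2 * q := by ring
        rw [Pi.single_eq_of_ne (by omega), pattern_of_gt (by omega),
          comb_eq_zero_of_lt (a := r * (s + 1 + v) + 2) (by omega) (by omega)]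
        ring
  rw [H.adm.skewDefect_eq_zero, skewDefect_add, skewDefect_add,
    skewDefect_single_of_odd (e := d) _ (by omega) (by omega) (by omega) H.d_odd hab, hbchoose,
    hbodd] at hexp
  -- If `p^t < d`, the correction has coefficient zero by Lucas, and what remains is `2 ε_i = 0`. If
  -- `p^t = d`, then `ε_i = 1` and the equation says that the defect of the model is `1`. It is `0`
  -- for `v < p^l`, and `c + 2` for `v = p^l`, which leads to the third shift with `c + 2 ≡ 1`.
  rcases hptd.lt_or_eq with hlt | heq
  · have hda : d ∣ Q * (c + 1) + q * r * v + 2 * q := (dvd_mul_right d p).trans hW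
    have hdb : d ∣ b := by
      have h1 := (dvd_mul_right d p).trans hbdvd
      rw [← hb] at h1
      exact (Nat.dvd_add_iff_left dvd_rfl).2 h1
    have z1 : (a.choose (d - p ^ t) : K) = 0 := by
      obtain ⟨g, hg⟩ := hda
      obtain ⟨g, rfl⟩ : ∃ g', g = g' + 1 := by
        refine Nat.exists_eq_add_of_le' (Nat.pos_of_ne_zero ?_)
        rintro rfl
        omega
      have hg' : d * (g + 1) = d * g + d := Nat.mul_succ _ _
      rw [show a = p ^ β * g + (d - p ^ t - 1) by rw [← H.d_eq]; omega]
      exact choose_eq_zero_of_lt p H.prime H.ne_two (by rw [← H.d_eq]; omega) (by omega)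
    have z2 : (b.choose (d - p ^ t) : K) = 0 := by
      obtain ⟨g, hg⟩ := hdb
      have h1 := choose_eq_zero_of_lt (K := K) p H.prime H.ne_two (v := β) (a := g) (b := 0)
        (e := d - p ^ t) (by have := H.d_eq; omega) (by omega)
      rwa [add_zero, ← H.d_eq, ← hg] at h1
    have z3 : skewDefect (pattern (K := K) q r d s) a b = 0 := by
      rcases e6 with rfl | h1
      · exact skewDefect_pattern_eq_zero_after p H.prime H.ne_two hr H.qr_eq H.d_eq (by omega)
          ((dvd_mul_right d p).trans H.dvd_q) (e := d - p ^ t) H.Q_eq_pow hQ H.dvd_Q hs hb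
          (by rw [← H.Q_eq] at ha; omega) (by omega) (by omega)
      · exact hvan a (2 * q - p ^ t + d) (by omega) (by omega) (by omega)
    have z4 : (a.choose d : K) = -1 := by
      simpa using H.choose_eq (a := a) (m := 1) (e := d - 1 - p ^ t) hW (by omega) (by omega)
    rw [skewDefect_single_of_choose_eq_zero (e := d - p ^ t) _ (by omega) (by omega) (by omega) z1
      z2, z3, z4] at hexp
    have h1 : (2 : K) * ε i = 0 := by linear_combination hexp
    exact hi0 ((mul_eq_zero.1 h1).resolve_left H.two_ne_zero')
  · have z4 : (a.choose d : K) = -2 := by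
      simpa using H.choose_eq (a := a) (m := 2) (e := d - 1) hW (by omega) (by omega)
    obtain ⟨h1, h2⟩ := H.eq_one_of_short_gap (by omega) hN1 (by omega) hi0 hbefore
      fun x h1 h2 => by rw [hagree x (by omega) h2, hzero x h1 (by omega)]
    rw [skewDefect_single_last _ (by omega) hab, hbodd, z4, h1] at hexp
    rcases e6 with rfl | h3
    · rw [← H.Q_eq] at *
      rw [skewDefect_pattern_eq p H.prime H.ne_two hr2 H.qr_eq H.d_eq (by omega) H.Q_eq_pow hQ hs
        H.odd_c hb (by omega)] at hexp
      refine H.false_of_third_shift (by omega) hagree hafter h2 ?_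
      push_cast
      linear_combination -hexp
    · rw [hvan a (2 * q) (by omega) (by omega) (by omega)] at hexp
      exact one_ne_zero (by linear_combination hexp : (1 : K) = 0)

end StartsLikePattern

/-! ### Continuation of the pattern, and the contradiction. -/

namespace StartsLikePattern

variable {K : Type*} [Field K] {p h k β l c q r d s Q : ℕ} {ε : ℕ → K}
  (H : StartsLikePattern p h k β l c q r d s Q ε)
include H

/-- Inside a period the pattern continues. -/
theorem eq_pattern_of_mid {N i v j : ℕ} (hv : v < p ^ l) (hj1 : 2 ≤ j) (hj2 : j < r)
    (hN : N + 2 * d = q * r * (s + 1 + v) + q * j) (hi : i = N + q)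
    (hagree : ∀ x, 1 ≤ x → x < i → ε x = pattern q r d s x) : ε i = pattern q r d s i := by
  have := H.charP
  have hr := H.three_le_r
  have hr2 : 2 ≤ r := by omega
  have hd := H.three_mul_d_le
  have hd0 := H.d_pos
  have hqr := H.three_mul_q_le
  have hQ := H.qr_le_Q
  have hs := H.qr_mul_s
  have e1 : q * r * (s + 1) = q * r * s + q * r := Nat.mul_succ _ _
  have e1' : q * r * (s + 1 + v) = q * r * s + q * r + q * r * v := by ring
  have e2 : Q * (c + 2) = Q * c + Q + Q := by ring
  have e3 : Q * (c + 1) = Q * c + Q := Nat.mul_succ _ _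
  have e5 : q * r * v + q * r ≤ Q := by
    rw [H.Q_eq, ← Nat.mul_succ]
    exact Nat.mul_le_mul_left _ hv
  have e6 : q * 2 ≤ q * j := Nat.mul_le_mul_left _ hj1
  have e7 : q * j + q ≤ q * r := by
    rw [← Nat.mul_succ]
    exact Nat.mul_le_mul_left _ hj2
  have hq0 : 0 < q := by omega
  have eN : q * (r * (s + 1 + v) + j) = q * r * (s + 1 + v) + q * j := by ring
  have ei : q * (r * (s + 1 + v) + j + 1) = q * r * (s + 1 + v) + q * j + q := by ring
  have hN1 : ε N = 1 := by
    rw [hagree N (by omega) (by omega), pattern_of_gt (by omega), hN, ← eN]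
    exact comb_mul_eq_one hq0 (by rw [Nat.mul_add_mod, Nat.mod_eq_of_lt hj2]; omega)
  have hbefore : ∀ x, N < x + q → x < N → ε x = 0 := fun x h1 h2 => by
    rw [hagree x (by omega) (by omega), pattern_of_gt (by omega)]
    obtain ⟨j, rfl⟩ := Nat.exists_eq_add_of_le' (show 1 ≤ j by omega)
    have e8 : q * (r * (s + 1 + v) + j) + q = q * r * (s + 1 + v) + q * (j + 1) := by ring
    exact comb_eq_zero_of_lt (a := r * (s + 1 + v) + j) (by omega) (by omega)
  have hbetween : ∀ x, N < x → x < i → ε x = 0 := fun x h1 h2 => by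
    rw [hagree x (by omega) (by omega), pattern_of_gt (by omega)]
    exact comb_eq_zero_of_lt (a := r * (s + 1 + v) + j) (by omega) (by omega)
  have hpattern : ∀ x, i < x → x ≤ i + d → pattern (K := K) q r d s x = 0 := fun x h1 h2 => by
    rw [pattern_of_gt (by omega)]
    exact comb_eq_zero_of_lt (a := r * (s + 1 + v) + j + 1) (by omega) (by omega)
  -- If `ε i = 0`, a nonzero term here would close a gap of length at most `q + d ≤ 4q/3`, whereas
  -- the permitted lengths `2q - p^t` with `t < h` are at least `5q/3`.
  have hafter : ∀ x, i < x → x ≤ i + d → ε x = 0 := by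
    by_cases hi0 : ε i = 0
    · intro x
      induction x using Nat.strong_induction_on with
      | _ x ih =>
        intro h1 h2
        by_contra hx
        obtain ⟨y, rfl⟩ := Nat.exists_eq_add_of_le (show N ≤ x by omega)
        obtain ⟨t, ht, hyt⟩ := H.gap_length (by omega) (by rw [hN1]; exact one_ne_zero) hbefore
          (fun z h3 h4 => by
            rcases lt_trichotomy z i with h5 | rfl | h5
            · exact hbetween z h3 h5
            · exact hi0
            · exact ih z h4 h5 (by omega)) (by omega) (by omega) hx
        have := H.three_mul_pow_le ht
        omega
    · intro x h1 h2
      exact H.zero_after (by omega) hi0 (fun x h1 h2 => hbetween x (by omega) h2) x h1 (by omega)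
  have hagree' : ∀ x, i < x → x ≤ i + d → ε x = pattern q r d s x := fun x h1 h2 => by
    rw [hafter x h1 h2, hpattern x h1 h2]
  -- The splitting with `b = q r + Q - d` needs a full period after the second shift. In the first
  -- period `a` is taken near `q r + q` instead; at odd weights the defect then vanishes because `s`
  -- is odd.
  rcases Nat.eq_zero_or_pos v with rfl | hv0
  · obtain ⟨s', rfl⟩ : ∃ s', s = s' + 1 := Nat.exists_eq_add_of_le' (by
      rw [H.s_eq]
      exact Nat.mul_pos (pow_pos H.prime.pos l) (by omega))
    have hs' : Even s' := by
      have h1 : Odd (s' + 1) := by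
        rw [H.s_eq]
        exact (H.prime.odd_of_ne_two H.ne_two).pow.mul (H.odd_c.add_even even_two)
      rw [Nat.odd_add_one] at h1
      exact Nat.not_odd_iff_even.1 h1
    obtain ⟨b, hb⟩ : ∃ b, b + d = q * r * (s' + 1) + q * j :=
      ⟨q * r * (s' + 1) + q * j - d, by omega⟩
    rcases Nat.even_or_odd i with heven | hodd
    · refine H.adm.eq_of_even H.two_ne_zero' (d := d) (a := q * r + q - 1) (b := b) hagree hagree'
        (by omega) heven H.d_odd (by omega) (by omega)
        (skewDefect_pattern_first_shifted p H.prime H.ne_two H.q_eq H.r_eq hr2 H.d_eq (by omega)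
          (by omega) hb (by omega)) ?_
      have h1 := H.choose_eq (a := q * r + q - 1) (m := 1) (w := q * r + q) (e := d - 1)
        (dvd_add (H.dvd_q.mul_right r) H.dvd_q) (by omega) (by omega)
      have h2 := H.choose_eq (a := b) (m := 1) (w := q * r * (s' + 1) + q * j) (e := 0)
        (dvd_add ((H.dvd_q.mul_right r).mul_right _) (H.dvd_q.mul_right j)) hd0 (by omega)
      rw [h1, h2]
      push_cast
      ring
    · refine H.adm.eq_of_odd H.two_ne_zero' (a := q * r + q - d - 1) (b := b) hagree (by omega)
        hodd ?_
      rw [skewDefect_pattern_first p H.prime H.ne_two H.q_eq H.r_eq hr2 H.d_eq (by omega)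
        (by omega) hj2 hb (by omega), hs'.neg_one_pow, sub_self]
  · have e8 : q * r * 1 ≤ q * r * v := Nat.mul_le_mul_left _ hv0
    obtain ⟨b, hb⟩ : ∃ b, b + d = q * r + Q := ⟨q * r + Q - d, by omega⟩
    have hvan : ∀ a J, a + 1 + d = Q * (c + 1) + q * r * v + J → 1 ≤ J →
        q * r * v + J < Q + 2 * q → skewDefect (pattern (K := K) q r d s) a b = 0 :=
      fun a J ha hJ hlt => skewDefect_pattern_eq_zero p H.prime H.ne_two hr2 H.qr_eq H.d_eq
        (by omega) H.Q_eq_pow hQ hs hb ha hv0 hJ hlt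
    rcases Nat.even_or_odd i with heven | hodd
    · obtain ⟨a, ha⟩ : ∃ a, a + 1 = Q * (c + 1) + q * r * v + (q * j + q) :=
        ⟨Q * (c + 1) + q * r * v + (q * j + q) - 1, by omega⟩
      refine H.adm.eq_of_even H.two_ne_zero' (d := d) (a := a) (b := b) hagree hagree'
        (by omega) heven H.d_odd (by omega) (by omega)
        (hvan a (q * j + q + d) (by omega) (by omega) (by omega)) ?_
      have h1 := H.choose_eq (a := a) (m := 1) (w := Q * (c + 1) + q * r * v + (q * j + q))
        (e := d - 1) (dvd_add (dvd_add ((H.dvd_q.trans H.dvd_Q).mul_right _)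
          ((H.dvd_q.mul_right r).mul_right v)) (dvd_add (H.dvd_q.mul_right j) H.dvd_q))
        (by omega) (by omega)
      have h2 := H.choose_eq (a := b) (m := 1) (w := q * r + Q) (e := 0)
        (dvd_add (H.dvd_q.mul_right r) (H.dvd_q.trans H.dvd_Q)) hd0 (by omega)
      rw [h1, h2]
      push_cast
      ring
    · refine H.adm.eq_of_odd H.two_ne_zero'
        (a := Q * (c + 1) + q * r * v + (q * j + q) - d - 1) (b := b) hagree (by omega) hodd ?_
      exact hvan _ (q * j + q) (by omega) (by omega) (by omega)

/-- The pattern continues for another `p ^ l` periods. -/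
theorem agree_up_to : ∀ i, 1 ≤ i → i + 2 * d ≤ q * r * (s + 1) + Q + 2 * q →
    ε i = pattern q r d s i := by
  have hr := H.three_le_r
  have hr2 : 2 ≤ r := by omega
  have hd := H.three_mul_d_le
  have hd0 := H.d_pos
  have hqr := H.three_mul_q_le
  have hQ := H.qr_le_Q
  have hq0 : 0 < q := by omega
  intro i
  induction i using Nat.strong_induction_on with
  | _ i ih =>
    intro hi1 hi2
    have hagree : ∀ x, 1 ≤ x → x < i → ε x = pattern q r d s x :=
      fun x h1 h2 => ih x h2 h1 (by omega)
    rcases Nat.lt_or_ge (q * r * (s + 1) + 2 * q) (i + 2 * d) with hlt | hle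
    swap
    · exact H.agree i hi1 hle
    -- Here `1 ≤ e + 1 ≤ q`, so `q A` is the last multiple of `q` strictly before `i + 2d`. In `A =
    -- r (s + 1 + v) + j`, the value `j = 1` marks the missing tooth, and `j = 0` the first half of
    -- a gap `2q`.
    obtain ⟨A, e, hAe, he⟩ : ∃ A e, i + 2 * d = q * A + e + 1 ∧ e < q :=
      ⟨(i + 2 * d - 1) / q, (i + 2 * d - 1) % q, by
        have := Nat.div_add_mod (i + 2 * d - 1) q
        omega, Nat.mod_lt _ hq0⟩
    have e0 : q * (r * (s + 1) + 2) = q * r * (s + 1) + 2 * q := by ring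
    have hA : r * (s + 1) + 2 ≤ A := by
      by_contra hlt'
      have h1 : q * (A + 1) ≤ q * (r * (s + 1) + 2) := Nat.mul_le_mul_left q (by omega)
      rw [Nat.mul_succ] at h1
      omega
    obtain ⟨v, j, hAj, hj⟩ : ∃ v j, A = r * (s + 1 + v) + j ∧ j < r := by
      refine ⟨A / r - (s + 1), A % r, ?_, Nat.mod_lt _ (by omega)⟩
      have h1 : s + 1 ≤ A / r := (Nat.le_div_iff_mul_le (by omega)).2 (by rw [mul_comm]; omega)
      rw [Nat.add_sub_cancel' h1, Nat.div_add_mod]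
    have eA : q * A = q * r * (s + 1) + q * r * v + q * j := by rw [hAj]; ring
    have e1 : q * r * (s + 1 + v) = q * r * (s + 1) + q * r * v := by ring
    have hvle : ∀ w, q * r * v < Q + q * r * w → v < p ^ l + w := fun w hw => by
      rw [H.Q_eq, ← Nat.mul_add] at hw
      exact lt_of_mul_lt_mul_left hw (Nat.zero_le _)
    rcases eq_or_ne j 1 with rfl | hj1
    · have hv1 : 1 ≤ v := by
        by_contra h0
        obtain rfl : v = 0 := by omega
        rw [add_zero] at hAj
        omega
      have h1 : q * r * 1 ≤ q * r * v := Nat.mul_le_mul_left _ hv1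
      have hvl : v ≤ p ^ l := by
        have := hvle 1 (by omega)
        omega
      obtain ⟨N, hN⟩ : ∃ N, N + 2 * d = q * r * (s + 1 + v) :=
        ⟨q * r * (s + 1 + v) - 2 * d, by omega⟩
      have hN1 : ε N = 1 := by
        rw [hagree N (by omega) (by omega), pattern_of_gt (by omega), hN,
          show q * r * (s + 1 + v) = q * (r * (s + 1 + v)) by ring]
        exact comb_mul_eq_one hq0 (by rw [Nat.mul_mod_right]; exact zero_ne_one)
      have hzero : ∀ x, N < x → x < N + 2 * q → pattern (K := K) q r d s x = 0 :=
        fun x h1 h2 => by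
          rw [pattern_of_gt (by omega)]
          exact comb_eq_zero_of_gap hr2 (b := s + 1 + v) (by omega) (by omega)
      rcases Nat.lt_or_ge (e + 1) q with he1 | he1
      · rw [hzero i (by omega) (by omega)]
        by_contra hi0
        obtain ⟨y, rfl⟩ := Nat.exists_eq_add_of_le (show N ≤ i by omega)
        have hbefore : ∀ x, N < x + q → x < N → ε x = 0 := fun x h1 h2 => by
          rw [hagree x (by omega) (by omega), pattern_of_gt (by omega)]
          obtain ⟨g, hg⟩ : ∃ g, q * g + q = q * r * (s + 1 + v) := by
            refine ⟨r * (s + 1 + v) - 1, ?_⟩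
            rw [← Nat.mul_succ, Nat.succ_eq_add_one, Nat.sub_add_cancel, mul_assoc]
            exact Nat.mul_pos (by omega) (by omega)
          exact comb_eq_zero_of_lt (a := g) (by omega) (by omega)
        obtain ⟨t, ht, hyt⟩ := H.gap_length (by omega) (by rw [hN1]; exact one_ne_zero) hbefore
          (fun x h1 h2 => by rw [hagree x (by omega) h2, hzero x h1 (by omega)])
          (by omega) (by omega) hi0
        exact hi0 (H.eq_zero_of_end hv1 hvl ht.le hN (by omega) hagree)
      · have h2 := H.one_of_full_gap (by omega) hN1 fun x h1 h2 => by
          rw [hagree x (by omega) (by omega), hzero x h1 h2]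
        rw [show i = N + 2 * q by omega, h2, pattern_of_gt (by omega),
          show N + 2 * q + 2 * d = q * 2 + q * r * (s + 1 + v) by omega, comb_add_period hq0,
          comb_mul_eq_one hq0 (by rw [Nat.mod_eq_of_lt (by omega)]; omega)]
    · obtain ⟨N, hN⟩ : ∃ N, N + 2 * d = q * A := ⟨q * A - 2 * d, by
        have := Nat.mul_le_mul_left q hA
        omega⟩
      have hNA := Nat.mul_le_mul_left q hA
      have hN1 : ε N = 1 := by
        rw [hagree N (by omega) (by omega), pattern_of_gt (by omega), hN, hAj]
        exact comb_mul_eq_one hq0 (by rw [Nat.mul_add_mod, Nat.mod_eq_of_lt hj]; exact hj1)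
      rcases Nat.lt_or_ge (e + 1) q with he1 | he1
      · have hbefore : ∀ x, N < x + q → x < N → ε x = 0 := fun x h1 h2 => by
          rw [hagree x (by omega) (by omega), pattern_of_gt (by omega)]
          obtain ⟨g, rfl⟩ := Nat.exists_eq_add_of_le' (show 1 ≤ A by omega)
          rw [Nat.mul_succ] at hN
          exact comb_eq_zero_of_lt (a := g) (by omega) (by omega)
        rw [H.zero_after (by omega) (by rw [hN1]; exact one_ne_zero) hbefore i (by omega)
          (by omega), pattern_of_gt (by omega),
          comb_eq_zero_of_lt (a := A) (by omega) (by omega)]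
      · rcases Nat.eq_zero_or_pos j with rfl | hj0
        · have hv1 : 1 ≤ v := by
            by_contra h0
            obtain rfl : v = 0 := by omega
            rw [add_zero, add_zero] at hAj
            omega
          have hvl : v ≤ p ^ l := by
            have := hvle 1 (by omega)
            omega
          rw [H.eq_zero_of_end (N := N) (t := h) hv1 hvl le_rfl (by omega)
            (by rw [← H.q_eq]; omega) hagree, pattern_of_gt (by omega)]
          exact (comb_eq_zero_of_gap hr2 (b := s + 1 + v) (by omega) (by omega)).symm
        · have h1 : q * 2 ≤ q * j := Nat.mul_le_mul_left _ (by omega)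
          have hvl : v < p ^ l := by
            have := hvle 0 (by omega)
            omega
          exact H.eq_pattern_of_mid (N := N) hvl (by omega) hj (by omega) (by omega) hagree

/-- Agreement now reaches the weight where the defect of the model is `c + 2`, so admissibility
would force `p ∣ c + 2`. -/
theorem absurd : False := by
  have := H.charP
  have hr := H.three_le_r
  have hd := H.three_mul_d_le
  have hqr := H.three_mul_q_le
  have hQ := H.qr_le_Q
  have hs := H.qr_mul_s
  have hd0 := H.d_pos
  have e1 : q * r * (s + 1) = q * r * s + q * r := Nat.mul_succ _ _
  have h1 := skewDefect_pattern_eq (K := K) p H.prime H.ne_two (s := s) (by omega) H.qr_eq H.d_eq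
    (by omega) H.Q_eq_pow hQ hs H.odd_c (b := q * r + Q - d) (a := Q * (c + 2) + 2 * q - d - 1)
    (by omega) (by omega)
  rw [← skewDefect_congr fun x hx1 hx2 => H.agree_up_to x hx1 (by omega),
    H.adm.skewDefect_eq_zero] at h1
  have h2 : ((c + 2 : ℕ) : K) = 0 := by
    push_cast
    exact h1.symm
  rw [CharP.cast_eq_zero_iff K p] at h2
  exact H.not_dvd h2

end StartsLikePattern

/-! ### From constituent lengths to the model sequence. -/

section Positions

/-- Starting from `i`, the consecutive positions at which `g` holds have the given differences. -/
def HasGapsFrom (g : ℕ → Prop) : ℕ → List ℕ → Prop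
  | _, [] => True
  | i, m :: ms => (1 ≤ m ∧ g (i + m) ∧ ∀ j, i < j → j < i + m → ¬g j) ∧ HasGapsFrom g (i + m) ms

variable {g g' : ℕ → Prop}

theorem hasGapsFrom_append {i : ℕ} {l l' : List ℕ} :
    HasGapsFrom g i (l ++ l') ↔ HasGapsFrom g i l ∧ HasGapsFrom g (i + l.sum) l' := by
  induction l generalizing i with
  | nil => simp [HasGapsFrom]
  | cons m ms ih => simp only [List.cons_append, HasGapsFrom, ih, List.sum_cons, and_assoc,
      add_assoc]

theorem hasGapsFrom_singleton {i m : ℕ} :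
    HasGapsFrom g i [m] ↔ 1 ≤ m ∧ g (i + m) ∧ ∀ j, i < j → j < i + m → ¬g j := by
  simp [HasGapsFrom]

theorem hasGapsFrom_flatten_replicate {l : List ℕ} {i n : ℕ}
    (h : ∀ t, t < n → HasGapsFrom g (i + l.sum * t) l) :
    HasGapsFrom g i (List.replicate n l).flatten := by
  induction n generalizing i with
  | zero => simp [HasGapsFrom]
  | succ n ih =>
    rw [List.replicate_succ, List.flatten_cons, hasGapsFrom_append]
    refine ⟨by simpa using h 0 (by omega), ih fun t ht => ?_⟩
    have := h (t + 1) (by omega)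
    rwa [Nat.mul_succ, add_comm (l.sum * t), ← add_assoc] at this

theorem hasGapsFrom_replicate {i m n : ℕ} (h : ∀ t, t < n → HasGapsFrom g (i + m * t) [m]) :
    HasGapsFrom g i (List.replicate n m) := by
  have := hasGapsFrom_flatten_replicate (l := [m]) (i := i) (n := n) (g := g) (by simpa using h)
  simpa using this

/-- A list of gaps determines the set of positions, so it suffices that the centralizers and the
model share one list. -/
theorem HasGapsFrom.iff {i : ℕ} {l : List ℕ} (h : HasGapsFrom g i l) (h' : HasGapsFrom g' i l)
    {x : ℕ} (h1 : i < x) (h2 : x ≤ i + l.sum) : g x ↔ g' x := by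
  induction l generalizing i with
  | nil => simp at h2; omega
  | cons m ms ih =>
    obtain ⟨⟨-, h3, h4⟩, h5⟩ := h
    obtain ⟨⟨-, h3', h4'⟩, h5'⟩ := h'
    rw [List.sum_cons] at h2
    rcases lt_trichotomy x (i + m) with h6 | rfl | h6
    · exact iff_of_false (h4 x h1 h6) (h4' x h1 h6)
    · exact iff_of_true h3 h3'
    · exact ih h5 h5' h6 (by omega)

theorem HasConstituentsFrom.hasGapsFrom {F L : Type*} [Field F] [LieRing L] [LieAlgebra F L]
    {A : ℕ → Submodule F L} {i : ℕ} {l : List ℕ} (h : HasConstituentsFrom A i l) :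
    HasGapsFrom (fun x => twoStepCentralizer A x ≠ twoStepCentralizer A 2) i l := by
  induction l generalizing i with
  | nil => trivial
  | cons m ms ih =>
    obtain ⟨⟨-, h2, -, h4, h5⟩, h6⟩ := h
    exact ⟨⟨h2, h4, fun j h7 h8 h9 => h9 (h5 j h7 h8)⟩, ih h6⟩

variable {K : Type*} [Field K] {q r d s : ℕ}

theorem comb_block_ne_zero (hq : 0 < q) {b i : ℕ} (h1 : 2 ≤ i) (h2 : i ≤ r) :
    comb (K := K) q r (q * i + q * r * b) ≠ 0 := by
  rw [comb_add_period hq, comb_mul_eq_one hq]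
  · exact one_ne_zero
  · rcases h2.lt_or_eq with h3 | h3
    · rw [Nat.mod_eq_of_lt h3]
      omega
    · rw [h3, Nat.mod_self]
      exact zero_ne_one

/-- `e` is the shift accumulated so far: `0` in the first period and `d` between the two shifts. -/
theorem hasGapsFrom_block (hq : 0 < q) {b e : ℕ} (he : e ≤ q)
    (hg : ∀ x, q * r * b + 2 * q < x + e → x + e ≤ q * r * b + q * r →
      (g x ↔ comb (K := K) q r (x + e) ≠ 0)) :
    HasGapsFrom g (q * r * b + 2 * q - e) (List.replicate (r - 2) q) := by
  refine hasGapsFrom_replicate fun t ht => hasGapsFrom_singleton.2 ?_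
  have h1 : q * (t + 3) ≤ q * r := Nat.mul_le_mul_left q (by omega)
  have h2 : q * (t + 3) = q * t + 3 * q := by ring
  have h3 : q * (r * b + t + 2) = q * r * b + q * t + 2 * q := by ring
  refine ⟨hq, ?_, fun j hj1 hj2 => ?_⟩
  · rw [hg _ (by omega) (by omega),
      show q * r * b + 2 * q - e + q * t + q + e = q * (t + 3) + q * r * b by omega]
    exact comb_block_ne_zero hq (by omega) (by omega)
  · rw [hg _ (by omega) (by omega), not_not]
    exact comb_eq_zero_of_lt (a := r * b + t + 2) (by omega) (by omega)

theorem hasGapsFrom_pattern (hr : 2 ≤ r) (hd0 : 0 < d) (hd : d < q) (hs : 1 ≤ s) :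
    HasGapsFrom (fun x => pattern (K := K) q r d s x ≠ 0) (2 * q) (initialPattern q r d s).tail := by
  have hq : 0 < q := by omega
  have hqr : q * r = q * (r - 2) + 2 * q := by
    obtain ⟨m, rfl⟩ := Nat.exists_eq_add_of_le hr
    rw [Nat.add_sub_cancel_left]
    ring
  have hmono : ∀ {a b : ℕ}, a ≤ b → q * r * a ≤ q * r * b := fun h => Nat.mul_le_mul_left _ h
  have hsucc : ∀ b : ℕ, q * r * (b + 1) = q * r * b + q * r := fun b => Nat.mul_succ _ _
  have hsum : (List.replicate (r - 2) q).sum = q * (r - 2) := by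
    rw [List.sum_replicate, smul_eq_mul, mul_comm]
  have hblock : ∀ b, 1 ≤ b → b ≤ s → HasGapsFrom (fun x => pattern (K := K) q r d s x ≠ 0)
      (q * r * b + 2 * q - d) (List.replicate (r - 2) q) := fun b h1 h2 => by
    refine hasGapsFrom_block (K := K) hq hd.le fun x hx1 hx2 => ?_
    have := hmono h1
    have := hmono h2
    rw [pattern_of_mid (by omega) (by rw [hsucc]; omega)]
  have hlist : (initialPattern q r d s).tail = List.replicate (r - 2) q ++ ([2 * q - d] ++
      ((List.replicate (s - 1) (List.replicate (r - 2) q ++ [2 * q])).flatten ++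
      (List.replicate (r - 2) q ++ [2 * q - d]))) := by
    simp [initialPattern]
  have hflat : ((List.replicate (s - 1) (List.replicate (r - 2) q ++ [2 * q])).flatten).sum =
      q * r * (s - 1) := by
    rw [List.sum_flatten, List.map_replicate, List.sum_replicate, List.sum_append, hsum,
      List.sum_singleton, ← hqr, smul_eq_mul, mul_comm]
  have hs1 : q * r * s = q * r * (s - 1) + q * r := by
    rw [← hsucc, Nat.sub_add_cancel hs]
  rw [hlist, hasGapsFrom_append, hasGapsFrom_append, hasGapsFrom_append, hasGapsFrom_append, hsum,
    hflat, List.sum_singleton, hasGapsFrom_singleton, hasGapsFrom_singleton]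
  have e1 : 2 * q + q * (r - 2) = q * r := by omega
  have e2 : q * r + (2 * q - d) = q * r * 1 + 2 * q - d := by omega
  have e3 : q * r * 1 + 2 * q - d + q * r * (s - 1) = q * r * s + 2 * q - d := by omega
  have e4 : q * r * s + 2 * q - d + q * (r - 2) = q * r * (s + 1) - d := by
    rw [hsucc]; omega
  rw [e1, e2, e3, e4]
  refine ⟨?_, ⟨by omega, ?_, fun j hj1 hj2 => ?_⟩,
    hasGapsFrom_flatten_replicate fun t ht => hasGapsFrom_append.2 ⟨?_, ?_⟩, hblock s hs le_rfl,
    by omega, ?_, fun j hj1 hj2 => ?_⟩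
  · have := hasGapsFrom_block (K := K) (r := r) (b := 0) (e := 0)
      (g := fun x => pattern (K := K) q r d s x ≠ 0) hq (Nat.zero_le _) fun x _ hx2 => by
        rw [pattern_of_le (by omega), add_zero]
    simpa using this
  · have := hmono hs
    rw [pattern_of_mid (by omega) (by rw [hsucc]; omega),
      show q * r * 1 + 2 * q - d + d = q * 2 + q * r * 1 by omega]
    exact comb_block_ne_zero hq le_rfl hr
  · have := hmono hs
    rw [pattern_of_mid (by omega) (by rw [hsucc]; omega), not_not]
    exact comb_eq_zero_of_gap hr (b := 1) (by omega) (by omega)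
  · have h1 := hsucc t
    rw [List.sum_append, hsum, List.sum_singleton, ← hqr,
      show q * r * 1 + 2 * q - d + q * r * t = q * r * (t + 1) + 2 * q - d by omega]
    exact hblock _ (by omega) (by omega)
  · have h0 := hsucc t
    have h2 : q * r * (t + 2) = q * r * (t + 1) + q * r := hsucc (t + 1)
    rw [List.sum_append, hsum, List.sum_singleton, ← hqr,
      show q * r * 1 + 2 * q - d + q * r * t + q * (r - 2) = q * r * (t + 2) - d by omega,
      hasGapsFrom_singleton]
    have h1 := hmono (show t + 2 ≤ s by omega)
    have h3 := hmono (show 1 ≤ t + 1 by omega)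
    have h4 := hsucc s
    refine ⟨by omega, ?_, fun j hj1 hj2 => ?_⟩
    · rw [pattern_of_mid (by omega) (by omega),
        show q * r * (t + 2) - d + 2 * q + d = q * 2 + q * r * (t + 2) by omega]
      exact comb_block_ne_zero hq le_rfl hr
    · rw [pattern_of_mid (by omega) (by omega), not_not]
      exact comb_eq_zero_of_gap hr (b := t + 2) (by omega) (by omega)
  · have h4 := hsucc s
    rw [pattern_of_gt (by omega),
      show q * r * (s + 1) - d + (2 * q - d) + 2 * d = q * 2 + q * r * (s + 1) by omega]
    exact comb_block_ne_zero hq le_rfl hr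
  · have h4 := hsucc s
    have h5 := hmono hs
    rcases le_or_gt j (q * r * (s + 1)) with h | h
    · rw [pattern_of_mid (by omega) h, not_not]
      exact comb_eq_zero_of_gap hr (b := s + 1) (by omega) (by omega)
    · rw [pattern_of_gt h, not_not]
      exact comb_eq_zero_of_gap hr (b := s + 1) (by omega) (by omega)

theorem sum_initialPattern (hr : 2 ≤ r) (hd : d ≤ 2 * q) (hs : 1 ≤ s) :
    (initialPattern q r d s).sum + 2 * d = q * r * (s + 1) + 2 * q := by
  obtain ⟨m, rfl⟩ := Nat.exists_eq_add_of_le hr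
  obtain ⟨t, rfl⟩ := Nat.exists_eq_add_of_le hs
  obtain ⟨u, hu⟩ := Nat.exists_eq_add_of_le hd
  have h1 : 2 * q - d = u := by omega
  simp only [initialPattern, List.sum_append, List.sum_singleton, List.sum_replicate,
    List.sum_flatten, List.map_replicate, smul_eq_mul, Nat.add_sub_cancel_left, h1]
  zify at hu ⊢
  linear_combination -2 * hu

theorem pattern_eq_zero_or_one (x : ℕ) :
    pattern (K := K) q r d s x = 0 ∨ pattern (K := K) q r d s x = 1 := by
  rw [pattern, comb]
  split_ifs <;> simp

/-- The constituent lengths determine which two-step centralizers differ from the first one. -/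
theorem ConstituentLengthsBeginWith.ne_iff_pattern {F L : Type*} [Field F] [LieRing L]
    [LieAlgebra F L] {A : ℕ → Submodule F L} (hr : 2 ≤ r) (hd0 : 0 < d) (hd : d < q) (hs : 1 ≤ s)
    (h : ConstituentLengthsBeginWith A (initialPattern q r d s)) {x : ℕ} (hx1 : 2 ≤ x)
    (hx2 : x + 2 * d ≤ q * r * (s + 1) + 2 * q) :
    twoStepCentralizer A x ≠ twoStepCentralizer A 2 ↔ pattern (K := K) q r d s x ≠ 0 := by
  have hlist : initialPattern q r d s = 2 * q :: (initialPattern q r d s).tail := by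
    simp [initialPattern]
  have hsum := sum_initialPattern (q := q) (d := d) (s := s) hr (by omega) hs
  have hq2 : q * 2 ≤ q * r := Nat.mul_le_mul_left q hr
  rw [hlist, List.sum_cons] at hsum
  rw [hlist] at h
  obtain ⟨⟨-, h1, h2⟩, h3⟩ := h
  rcases lt_trichotomy x (2 * q) with h4 | h4 | h4
  · refine iff_of_false (not_not.2 (h2 x hx1 h4)) (not_not.2 ?_)
    rw [pattern_of_le (by omega)]
    exact comb_eq_zero_of_gap hr (b := 0) (by omega) (by omega)
  · subst h4
    refine iff_of_true h1 ?_
    rw [pattern_of_le (by omega)]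
    have := comb_block_ne_zero (K := K) (q := q) (b := 0) (by omega) le_rfl hr
    rwa [mul_zero, add_zero, mul_comm] at this
  · exact h3.hasGapsFrom.iff (hasGapsFrom_pattern (K := K) hr hd0 hd hs) h4 (by omega)

end Positions

/-! ### Structure constants of an algebra of maximal class. -/

section StructureConstants

open scoped TensorProduct

/-- The structure constants of a sequence `e 1 = y`, `e (i + 1) = ⁅e i, z⁆` of nonzero elements of a
Lie algebra on which `y` acts as a weighted shift. -/
theorem isAdmissible_of_lie {K M : Type*} [Field K] [LieRing M] [LieAlgebra K M] {e : ℕ → M} {z : M}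
    {ε : ℕ → K} (h0 : ∀ i, 1 ≤ i → e i ≠ 0) (hz : ∀ i, 1 ≤ i → ⁅e i, z⁆ = e (i + 1))
    (hy : ∀ i, 1 ≤ i → ⁅e i, e 1⁆ = ε i • e (i + 1)) : IsAdmissible ε := by
  have hjac : ∀ u a b : M, ⁅u, ⁅a, b⁆⁆ = ⁅⁅u, a⁆, b⁆ - ⁅⁅u, b⁆, a⁆ := fun u a b => by
    rw [leibniz_lie u a b, ← lie_skew a ⁅u, b⁆, sub_eq_add_neg]
  -- Writing `e (k + 2) = ⁅e (k + 1), z⁆`, the Jacobi identity turns each further bracket with `z`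
  -- into one application of `1 - σ`.
  have key : ∀ k m, 1 ≤ m → ⁅e m, e (k + 1)⁆ = iterDiff ε m k • e (m + k + 1) := by
    intro k
    induction k with
    | zero => exact fun m hm => hy m hm
    | succ k ih =>
      intro m hm
      rw [← hz (k + 1) (by omega), hjac, ih m hm, hz m hm, ih (m + 1) (by omega), smul_lie,
        hz _ (by omega), iterDiff_succ, sub_smul, show m + 1 + k + 1 = m + k + 1 + 1 by omega]
      rfl
  refine ⟨fun a b => ?_, fun m k => ?_⟩
  · have h1 := lie_skew (e (a + 1)) (e (b + 1))
    rw [key a _ (by omega), key b _ (by omega), show b + 1 + a + 1 = a + 1 + b + 1 by omega,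
      ← neg_smul] at h1
    exact (smul_left_injective K (h0 _ (by omega)) h1).symm
  · have h1 := hjac (e (m + 1)) (e (k + 1)) (e 1)
    rw [hy _ (by omega), hy _ (by omega), lie_smul, key (k + 1) _ (by omega), key k _ (by omega),
      smul_lie, smul_lie, hy _ (by omega), key k _ (by omega),
      show m + 1 + (k + 1) + 1 = m + k + 3 by omega,
      show m + 1 + k + 1 + 1 = m + k + 3 by omega, show m + 1 + 1 + k + 1 = m + k + 3 by omega,
      smul_smul, smul_smul, smul_smul, ← sub_smul] at h1
    have h2 := smul_left_injective K (h0 _ (by omega)) h1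
    rw [show m + 1 + k + 1 = m + k + 2 by omega] at h2
    linear_combination -h2

/-- Extension of scalars to `F(X)` provides an element `x + X y` that acts by nonzero constants. -/
theorem exists_isAdmissible {F L : Type*} [Field F] [LieRing L] [LieAlgebra F L] {x : L}
    {v : ℕ → L} {α ε : ℕ → F} (h0 : ∀ i, 1 ≤ i → v i ≠ 0)
    (hx : ∀ i, 1 ≤ i → ⁅v i, x⁆ = α i • v (i + 1))
    (hy : ∀ i, 1 ≤ i → ⁅v i, v 1⁆ = ε i • v (i + 1))
    (hne : ∀ i, 1 ≤ i → α i ≠ 0 ∨ ε i ≠ 0) :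
    ∃ δ : ℕ → RatFunc F, IsAdmissible δ ∧ (∀ i, ε i = 0 → δ i = 0) ∧
      ∀ i, 1 ≤ i → α i = 0 → δ i = 1 := by
  let a : ℕ → RatFunc F := fun i => algebraMap F _ (α i) + RatFunc.X * algebraMap F _ (ε i)
  have ha : ∀ i, 1 ≤ i → a i ≠ 0 := fun i hi h => by
    have h1 : algebraMap (Polynomial F) (RatFunc F)
        (Polynomial.C (α i) + Polynomial.X * Polynomial.C (ε i)) = 0 := by
      rw [map_add, map_mul, RatFunc.algebraMap_X, RatFunc.algebraMap_C, RatFunc.algebraMap_C]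
      exact h
    have h2 := (map_eq_zero_iff _ (RatFunc.algebraMap_injective F)).1 h1
    have h3 := congrArg (fun f => f.coeff 0) h2
    have h4 := congrArg (fun f => f.coeff 1) h2
    simp [Polynomial.coeff_C] at h3 h4
    exact (hne i hi).elim (fun h => h h3) fun h => h h4
  -- The scaling that turns `v i` into `e i`. Starting from `c 1 = X` makes `e 1 = X y`, so the
  -- structure constant `X ε_i / (α_i + X ε_i)` is exactly `1` when `α_i = 0`.
  let c : ℕ → RatFunc F := fun i => RatFunc.X * ∏ j ∈ Finset.Ico 1 i, a j
  have hc0 : ∀ i, c i ≠ 0 := fun i => mul_ne_zero RatFunc.X_ne_zero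
    (Finset.prod_ne_zero_iff.2 fun j hj => ha j (Finset.mem_Ico.1 hj).1)
  have hc : ∀ i, 1 ≤ i → c (i + 1) = c i * a i := fun i hi => by
    simp only [c]
    rw [Finset.prod_Ico_succ_top hi, mul_assoc]
  have hc1 : c 1 = RatFunc.X := by simp [c]
  have htmul : ∀ (b : RatFunc F) (t : F) (u : L),
      b ⊗ₜ[F] (t • u) = (b * algebraMap F (RatFunc F) t) ⊗ₜ[F] u := fun b t u => by
    rw [TensorProduct.tmul_smul, TensorProduct.smul_tmul', Algebra.smul_def, mul_comm]
  refine ⟨fun i => RatFunc.X * algebraMap F _ (ε i) / a i,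
    isAdmissible_of_lie (K := RatFunc F) (M := RatFunc F ⊗[F] L) (e := fun i => c i ⊗ₜ[F] v i)
      (z := (1 : RatFunc F) ⊗ₜ[F] x + (RatFunc.X : RatFunc F) ⊗ₜ[F] v 1) ?_ ?_ ?_, ?_, ?_⟩
  · intro i hi h
    have h1 : c i • ((1 : RatFunc F) ⊗ₜ[F] v i) = 0 := by
      rw [TensorProduct.smul_tmul', smul_eq_mul, mul_one]
      exact h
    have h2 := (smul_eq_zero.1 h1).resolve_left (hc0 i)
    refine h0 i hi (Module.FaithfullyFlat.tensorProduct_mk_injective (A := F) (B := RatFunc F) L ?_)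
    rw [map_zero]
    exact h2
  · intro i hi
    rw [lie_add, LieAlgebra.ExtendScalars.bracket_tmul, LieAlgebra.ExtendScalars.bracket_tmul,
      hx i hi, hy i hi, htmul, htmul, ← TensorProduct.add_tmul, hc i hi]
    congr 1
    simp only [a]
    ring
  · intro i hi
    rw [LieAlgebra.ExtendScalars.bracket_tmul, hy i hi, htmul, TensorProduct.smul_tmul', hc i hi,
      hc1, smul_eq_mul]
    congr 1
    have := ha i hi
    field_simp
  · intro i hi
    simp [hi]
  · intro i hi h
    have h1 : a i = RatFunc.X * algebraMap F _ (ε i) := by simp [a, h]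
    simp only
    rw [← h1, div_self (ha i hi)]

variable {F L : Type*} [Field F] [LieRing L] [LieAlgebra F L] {A : ℕ → Submodule F L}

theorem twoStepCentralizer_le (i : ℕ) : twoStepCentralizer A i ≤ A 1 := fun _ h => h.1

variable [GradedLieAlgebra A]

namespace IsMaximalClass

theorem finite (hA : IsMaximalClass A) (i : ℕ) : FiniteDimensional F (A i) := by
  match i with
  | 0 => rw [hA.zero_eq_bot]; infer_instance
  | 1 => exact Module.finite_of_rank_eq_nat (n := 2) (by exact_mod_cast hA.rank_one)
  | i + 2 =>
    exact Module.rank_lt_aleph0_iff.1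
      ((hA.rank_le_one _ (by omega)).trans_lt Cardinal.one_lt_aleph0)

theorem finrank_one (hA : IsMaximalClass A) : Module.finrank F (A 1) = 2 :=
  Module.finrank_eq_of_rank_eq (by exact_mod_cast hA.rank_one)

/-- If `[L_i, L_1] = 0`, then `L_1 + ⋯ + L_i` is stable under `L_1`, hence under the algebra `L`
that it generates. It is then a subalgebra containing `L_1`, so it is `L`, which would have finite
dimension. -/
theorem exists_lie_ne_zero (hA : IsMaximalClass A) (hinf : ¬FiniteDimensional F L) {i : ℕ}
    (hi : 1 ≤ i) : ∃ u ∈ A i, ∃ w ∈ A 1, ⁅u, w⁆ ≠ 0 := by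
  by_contra! hcon
  have := hA.finite
  let B : Submodule F L := (Finset.Icc 1 i).sup A
  have hle : ∀ j, 1 ≤ j → j ≤ i → A j ≤ B := fun j h1 h2 =>
    Finset.le_sup (f := A) (Finset.mem_Icc.2 ⟨h1, h2⟩)
  have hB : ∀ w ∈ A 1, ∀ b ∈ B, ⁅w, b⁆ ∈ B := fun w hw => by
    change B ≤ B.comap (LieAlgebra.ad F L w)
    refine Finset.sup_le fun j hj u hu => ?_
    rw [Finset.mem_Icc] at hj
    rw [Submodule.mem_comap, LieAlgebra.ad_apply]
    rcases hj.2.lt_or_eq with h | rfl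
    · have h1 := SetLike.GradedBracket.bracket_mem hw hu
      exact hle _ (by omega) (by omega) h1
    · rw [← lie_skew, hcon u hu w hw, neg_zero]
      exact B.zero_mem
  let N : LieSubalgebra F L :=
    { carrier := {w | ∀ b ∈ B, ⁅w, b⁆ ∈ B}
      add_mem' := fun h h' b hb => by rw [add_lie]; exact B.add_mem (h b hb) (h' b hb)
      zero_mem' := fun b _ => by rw [zero_lie]; exact B.zero_mem
      smul_mem' := fun c w h b hb => by rw [smul_lie]; exact B.smul_mem c (h b hb)
      lie_mem' := fun h h' b hb => by
        rw [lie_lie]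
        exact B.sub_mem (h _ (h' b hb)) (h' _ (h b hb)) }
  have hN : (⊤ : LieSubalgebra F L) ≤ N := by
    rw [← hA.generated]
    exact LieSubalgebra.lieSpan_le.2 hB
  let B' : LieSubalgebra F L :=
    { B with lie_mem' := fun {w b} _ hb => hN (LieSubalgebra.mem_top w) b hb }
  have hB' : (⊤ : LieSubalgebra F L) ≤ B' := by
    rw [← hA.generated]
    exact LieSubalgebra.lieSpan_le.2 (hle 1 le_rfl hi)
  have htop : B = ⊤ := eq_top_iff.2 fun w _ => hB' (LieSubalgebra.mem_top w)
  have hfin : FiniteDimensional F B := Submodule.finiteDimensional_finset_sup _ A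
  rw [htop] at hfin
  exact hinf (Module.Finite.equiv (Submodule.topEquiv (R := F) (M := L)))

theorem exists_mem_ne_zero (hA : IsMaximalClass A) (hinf : ¬FiniteDimensional F L) {i : ℕ}
    (hi : 1 ≤ i) : ∃ u ∈ A i, u ≠ 0 := by
  obtain ⟨u, hu, w, -, h⟩ := hA.exists_lie_ne_zero hinf hi
  exact ⟨u, hu, fun h0 => h (by rw [h0, zero_lie])⟩

theorem exists_eq_smul (hA : IsMaximalClass A) {i : ℕ} (hi : 2 ≤ i) {u w : L} (hu : u ∈ A i)
    (hu0 : u ≠ 0) (hw : w ∈ A i) : ∃ c : F, w = c • u := by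
  obtain ⟨t, -, ht⟩ := (rank_submodule_le_one_iff (A i)).1 (hA.rank_le_one i hi)
  obtain ⟨a, rfl⟩ := Submodule.mem_span_singleton.1 (ht hu)
  obtain ⟨b, rfl⟩ := Submodule.mem_span_singleton.1 (ht hw)
  have ha : a ≠ 0 := fun h => hu0 (by rw [h, zero_smul])
  exact ⟨b / a, by rw [smul_smul, div_mul_cancel₀ _ ha]⟩

theorem mem_twoStepCentralizer_iff (hA : IsMaximalClass A) {i : ℕ} (hi : 2 ≤ i) {u w : L}
    (hu : u ∈ A i) (hu0 : u ≠ 0) (hw : w ∈ A 1) : w ∈ twoStepCentralizer A i ↔ ⁅u, w⁆ = 0 := by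
  refine ⟨fun h => h.2 u hu, fun h => ⟨hw, fun t ht => ?_⟩⟩
  obtain ⟨c, rfl⟩ := hA.exists_eq_smul hi hu hu0 ht
  rw [smul_lie, h, smul_zero]

theorem twoStepCentralizer_lt (hA : IsMaximalClass A) (hinf : ¬FiniteDimensional F L) {i : ℕ}
    (hi : 1 ≤ i) : twoStepCentralizer A i < A 1 := by
  obtain ⟨u, hu, w, hw, h⟩ := hA.exists_lie_ne_zero hinf hi
  exact SetLike.lt_iff_le_and_exists.2 ⟨twoStepCentralizer_le i, w, hw, fun h' => h (h'.2 u hu)⟩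

theorem finrank_twoStepCentralizer_le (hA : IsMaximalClass A) (hinf : ¬FiniteDimensional F L)
    {i : ℕ} (hi : 1 ≤ i) : Module.finrank F (twoStepCentralizer A i) ≤ 1 := by
  have := hA.finite 1
  have h := Submodule.finrank_lt_finrank_of_lt (hA.twoStepCentralizer_lt hinf hi)
  rw [hA.finrank_one] at h
  omega

/-- Bracketing with a generator of `L_i` maps the plane `L_1` to a space of dimension at most one,
so it has a kernel. -/
theorem exists_mem_twoStepCentralizer (hA : IsMaximalClass A) (hinf : ¬FiniteDimensional F L)
    {i : ℕ} (hi : 2 ≤ i) : ∃ w ∈ twoStepCentralizer A i, w ≠ 0 := by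
  obtain ⟨u, hu, hu0⟩ := hA.exists_mem_ne_zero hinf (show 1 ≤ i by omega)
  have := hA.finite
  let f : A 1 →ₗ[F] A (i + 1) := (LieAlgebra.ad F L u).restrict fun w hw =>
    SetLike.GradedBracket.bracket_mem hu hw
  have hf : LinearMap.ker f ≠ ⊥ := by
    refine LinearMap.ker_ne_bot_of_finrank_lt ?_
    rw [hA.finrank_one]
    exact Nat.lt_succ_of_le (Module.finrank_le_of_rank_le
      (by exact_mod_cast hA.rank_le_one (i + 1) (by omega)))
  obtain ⟨w, hw, hw0⟩ := (Submodule.ne_bot_iff _).1 hf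
  refine ⟨w, (hA.mem_twoStepCentralizer_iff hi hu hu0 w.2).2 ?_, fun h => hw0 (Subtype.ext h)⟩
  exact congrArg Subtype.val (LinearMap.mem_ker.1 hw)

theorem twoStepCentralizer_eq_span (hA : IsMaximalClass A) (hinf : ¬FiniteDimensional F L)
    {i : ℕ} (hi : 1 ≤ i) {w : L} (hw : w ∈ twoStepCentralizer A i) (hw0 : w ≠ 0) :
    twoStepCentralizer A i = F ∙ w := by
  have := hA.finite 1
  have := Submodule.finiteDimensional_of_le (twoStepCentralizer_le (A := A) i)
  have hle : F ∙ w ≤ twoStepCentralizer A i := (Submodule.span_singleton_le_iff_mem _ _).2 hw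
  refine (Submodule.eq_of_le_of_finrank_le hle ?_).symm
  rw [finrank_span_singleton hw0]
  exact hA.finrank_twoStepCentralizer_le hinf hi

/-- The sequence of two-step centralizers, as long as it involves only the first one and `C_n`, is
the sequence of zeros and ones of an admissible sequence. -/
theorem exists_isAdmissible (hA : IsMaximalClass A) (hinf : ¬FiniteDimensional F L) {n : ℕ}
    (hn : 2 ≤ n) (hne : twoStepCentralizer A n ≠ twoStepCentralizer A 2) :
    ∃ δ : ℕ → RatFunc F, IsAdmissible δ ∧ δ 1 = 0 ∧
      ∀ i, 2 ≤ i → (twoStepCentralizer A i = twoStepCentralizer A 2 → δ i = 0) ∧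
        (twoStepCentralizer A i = twoStepCentralizer A n → δ i = 1) := by
  have := hA.finite 1
  obtain ⟨y, hy, hy0⟩ := hA.exists_mem_twoStepCentralizer hinf le_rfl
  obtain ⟨x, hx, hx0⟩ := hA.exists_mem_twoStepCentralizer hinf hn
  have hCy := hA.twoStepCentralizer_eq_span hinf (by omega) hy hy0
  have hCx := hA.twoStepCentralizer_eq_span hinf (by omega) hx hx0
  have hsup : twoStepCentralizer A 2 ⊔ twoStepCentralizer A n = A 1 := by
    refine Submodule.eq_of_le_of_finrank_le
      (sup_le (twoStepCentralizer_le _) (twoStepCentralizer_le _)) ?_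
    have h1 : twoStepCentralizer A 2 < twoStepCentralizer A 2 ⊔ twoStepCentralizer A n := by
      refine lt_of_le_of_ne le_sup_left fun h => hne ?_
      have h2 : x ∈ twoStepCentralizer A 2 := by
        rw [h]
        exact Submodule.mem_sup_right hx
      rw [hCx, hA.twoStepCentralizer_eq_span hinf (by omega) h2 hx0]
    have := Submodule.finiteDimensional_of_le
      (sup_le (twoStepCentralizer_le (A := A) 2) (twoStepCentralizer_le n))
    have h3 := Submodule.finrank_lt_finrank_of_lt h1
    rw [hCy, finrank_span_singleton hy0, ← hCy] at h3
    rwa [hA.finrank_one]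
  have hspan : ∀ w ∈ A 1, ∃ a b : F, w = a • y + b • x := fun w hw => by
    rw [← hsup, hCy, hCx] at hw
    obtain ⟨_, h1, _, h2, rfl⟩ := Submodule.mem_sup.1 hw
    obtain ⟨a, rfl⟩ := Submodule.mem_span_singleton.1 h1
    obtain ⟨b, rfl⟩ := Submodule.mem_span_singleton.1 h2
    exact ⟨a, b, rfl⟩
  have hyx : ⁅y, x⁆ ≠ 0 := fun h => by
    obtain ⟨u, hu, w, hw, h1⟩ := hA.exists_lie_ne_zero hinf le_rfl
    obtain ⟨a, b, rfl⟩ := hspan u hu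
    obtain ⟨a', b', rfl⟩ := hspan w hw
    have h2 : ⁅x, y⁆ = 0 := by rw [← lie_skew, h, neg_zero]
    exact h1 (by simp [h, h2])
  choose! t ht ht0 using fun i (hi : 1 ≤ i) => hA.exists_mem_ne_zero hinf hi
  let v : ℕ → L := fun i => if i = 1 then y else if i = 2 then ⁅y, x⁆ else t i
  have hv1 : v 1 = y := rfl
  have hv2 : v 2 = ⁅y, x⁆ := rfl
  have hv : ∀ i, 1 ≤ i → v i ∈ A i ∧ v i ≠ 0 := fun i hi => by
    by_cases h1 : i = 1
    · subst h1
      exact ⟨hy.1, hy0⟩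
    by_cases h2 : i = 2
    · subst h2
      exact ⟨SetLike.GradedBracket.bracket_mem hy.1 hx.1, hyx⟩
    simp only [v, h1, h2, if_false]
    exact ⟨ht i hi, ht0 i hi⟩
  have hlie : ∀ i, 1 ≤ i → ∀ w ∈ A 1, ∃ c : F, ⁅v i, w⁆ = c • v (i + 1) := fun i hi w hw =>
    hA.exists_eq_smul (by omega) (hv _ (by omega)).1 (hv _ (by omega)).2
      (SetLike.GradedBracket.bracket_mem (hv i hi).1 hw)
  choose! α hα using fun i (hi : 1 ≤ i) => hlie i hi x hx.1
  choose! ε hε using fun i (hi : 1 ≤ i) => hlie i hi y hy.1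
  have hαε : ∀ i, 1 ≤ i → α i ≠ 0 ∨ ε i ≠ 0 := fun i hi => by
    rcases hi.eq_or_lt with rfl | h2
    · refine Or.inl fun h => ?_
      have := hα 1 le_rfl
      rw [h, zero_smul, hv1] at this
      exact hyx this
    · by_contra! h
      obtain ⟨u, hu, w, hw, h1⟩ := hA.exists_lie_ne_zero hinf hi
      obtain ⟨a, b, rfl⟩ := hspan w hw
      obtain ⟨c, rfl⟩ := hA.exists_eq_smul h2 (hv i hi).1 (hv i hi).2 hu
      exact h1 (by simp [hα i hi, hε i hi, h.1, h.2])
  obtain ⟨δ, hδ, hδ0, hδ1⟩ := MaxClass.exists_isAdmissible (fun i hi => (hv i hi).2) hα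
    (by rwa [hv1]) hαε
  have hzero : ∀ {i w} {c : F}, 1 ≤ i → ⁅v i, w⁆ = c • v (i + 1) → ⁅v i, w⁆ = 0 → c = 0 :=
    fun hi h1 h2 => (smul_eq_zero.1 (h1.symm.trans h2)).resolve_right (hv _ (by omega)).2
  refine ⟨δ, hδ, hδ0 1 (hzero le_rfl (hε 1 le_rfl) (lie_self y)), fun i hi => ⟨fun h => ?_,
    fun h => ?_⟩⟩
  · rw [← h] at hy
    exact hδ0 i (hzero (by omega) (hε i (by omega)) (hy.2 _ (hv i (by omega)).1))
  · rw [← h] at hx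
    exact hδ1 i (by omega) (hzero (by omega) (hα i (by omega)) (hx.2 _ (hv i (by omega)).1))

end IsMaximalClass

end StructureConstants

end MaxClass

theorem mainTheorem5 {F L : Type*} [Field F] [LieRing L] [LieAlgebra F L]
    (p : ℕ) (hp : p.Prime) (hp2 : p ≠ 2) [CharP F p]
    (A : ℕ → Submodule F L) [GradedLieAlgebra A]
    (hA : MaxClass.IsMaximalClass A) (hinf : ¬ FiniteDimensional F L)
    (h k β s : ℕ) (hk : 1 ≤ k) (hβ : β < h) (hs : 1 ≤ s)
    (hpat : MaxClass.ConstituentLengthsBeginWith A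
      (MaxClass.initialPattern (p ^ h) (p ^ k) (p ^ β) s))
    (htwo : MaxClass.OnlyFirstTwoUpTo A
      (MaxClass.initialPattern (p ^ h) (p ^ k) (p ^ β) s).sum) :
    ∃ l : ℕ, s = p ^ l := by
  obtain ⟨l, u, hu, rfl⟩ := Nat.exists_eq_pow_mul_and_not_dvd (show s ≠ 0 by omega) p hp.ne_one
  -- `u = 1` is the conclusion; any larger cofactor prime to `p` is contradictory.
  match u with
  | 0 => simp at hs
  | 1 => exact ⟨l, mul_one _⟩
  | c + 2 =>
    exfalso
    have hr : 2 ≤ p ^ k := hp.two_le.trans (Nat.le_self_pow (by omega) p)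
    have hd0 : 0 < p ^ β := pow_pos hp.pos β
    have hd : p ^ β < p ^ h := Nat.pow_lt_pow_right hp.one_lt hβ
    have hsum := MaxClass.sum_initialPattern (q := p ^ h) (d := p ^ β) hr (by omega) hs
    have hqr : p ^ h * 2 ≤ p ^ h * p ^ k := Nat.mul_le_mul_left _ hr
    obtain ⟨⟨hn, hne, hlt⟩, -⟩ := id hpat
    obtain ⟨δ, hδ, hδ1, hδC⟩ := hA.exists_isAdmissible hinf hn hne
    refine MaxClass.StartsLikePattern.absurd (K := RatFunc F) (p := p) (h := h) (k := k) (β := β)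
      (l := l) (c := c) (ε := δ) ⟨hp, hp2, inferInstance, rfl, rfl, rfl, rfl, rfl, hk, hβ, hu, hδ,
        fun x hx1 hx2 => ?_⟩
    rcases hx1.eq_or_lt with rfl | hx
    · rw [hδ1, MaxClass.pattern_of_le (by omega)]
      exact (MaxClass.comb_eq_zero_of_gap hr (b := 0) (by omega) (by omega)).symm
    have hiff := MaxClass.ConstituentLengthsBeginWith.ne_iff_pattern (K := RatFunc F) (A := A) hr
      hd0 hd hs hpat hx hx2
    by_cases hC : MaxClass.twoStepCentralizer A x = MaxClass.twoStepCentralizer A 2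
    · rw [(hδC x hx).1 hC]
      exact (not_not.1 fun h0 => hiff.2 h0 hC).symm
    · rw [(MaxClass.pattern_eq_zero_or_one x).resolve_left (hiff.1 hC)]
      refine (hδC x hx).2 ?_
      -- The second centralizer has a unique first occurrence, so this `n` must be `2q`.
      obtain ⟨n, ⟨hn', hne', hlt'⟩, hx'⟩ := (htwo x hx (by omega)).resolve_left hC
      rw [hx']
      rcases lt_trichotomy n (2 * p ^ h) with h1 | h1 | h1
      · exact absurd (hlt n hn' h1) hne'
      · rw [h1]
      · exact absurd (hlt' _ hn h1) hne
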